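/- Let $0<\kappa\le 1$, $\mu>1$ and $0<\nu<\infty$. Let $f^+,f^-$ be probability distributions on $\{0,1,2,\dots\}$ with finite moments of order $1+\kappa$ and common mean $\mu$, and let $g^+,g^-$ be probability distributions on $\{0,1,2,\dots\}$ with common mean $\nu$. A delayed branching process with offspring distributions $(g,f)$ is the process $(\hat Z_k)_{k\ge0}$ of generation sizes of a Galton–Watson tree with $\hat Z_0=1$ in which all individuals have independent numbers of children, distributed according to $g$ for the root and according to $f$ for every other individual. Let $(\hat Z^+_k)_{k\ge 0}$ and $(\hat Z^-_k)_{k\ge 0}$ be independent delayed branching processes with offspring distributions $(g^+,f^+)$ and $(g^-,f^-)$, respectively. Then the limits $$W^\pm=\lim_{k\to\infty}\frac{\hat Z^\pm_k}{\nu\mu^{k-1}}$$ exist almost surely (with finite values), and there exist constants $b>0$, $C<\infty$ and $n_0$ such that for all integers $n\ge n_0$ and all integers $k\ge1$ $$\left|E\left[\exp\left\{-\frac1{\nu n}\sum_{i=2}^{k+1}\hat Z^+_{\lceil i/2\rceil}\hat Z^-_{\lfloor i/2\rfloor}\right\}-\exp\left\{-\frac{\nu\mu^k}{(\mu-1)n}W^+W^-\right\}\right]\right|\le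 C\,n^{-b}.$$ -/

import Mathlib

open MeasureTheory ProbabilityTheory Filter Topology

/-- Generation sizes of a branching process started from one individual; `ξ (k, i)` is the number
of children of the `i`-th individual of generation `k` (individuals are numbered `0, 1, …`). -/
def generationSize (ξ : ℕ × ℕ → ℕ) : ℕ → ℕ
  | 0 => 1
  | k + 1 => ∑ i ∈ Finset.range (generationSize ξ k), ξ (k, i)

theorem measurable_generationSize : Measurable generationSize := by
  refine measurable_pi_lambda _ fun k => ?_
  induction k with
  | zero => exact measurable_const
  | succ k ih =>
    have h : Measurable (fun p : (ℕ × ℕ → ℕ) × ℕ => ∑ i ∈ Finset.range p.2, p.1 (k, i)) := by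
      refine measurable_from_prod_countable_left fun n => ?_
      dsimp only
      fun_prop
    exact h.comp (measurable_id.prodMk ih)

/-- The law, on sequences `ℕ → ℕ`, of the delayed branching process with offspring distributions
`(g, f)`: all offspring numbers are independent, that of the root (generation `0`) has law `g`,
and those of all other individuals have law `f`. -/
noncomputable def delayedBranchingLaw (g f : PMF ℕ) : Measure (ℕ → ℕ) :=
  (Measure.infinitePi fun p : ℕ × ℕ => (if p.1 = 0 then g else f).toMeasure).map generationSize

/-- The process `Z 0, Z 1, …` is a delayed branching process with offspring distributions
`(g, f)`. -/
def IsDelayedBranchingProcess {Ω : Type*} [MeasurableSpace Ω] (P : Measure Ω)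
    (g f : PMF ℕ) (Z : ℕ → Ω → ℕ) : Prop :=
  HasLaw (fun ω k => Z k ω) (delayedBranchingLaw g f) P

/-- The distribution `p` on `ℕ` has (finite) mean `m`. -/
def HasMean (p : PMF ℕ) (m : ℝ) : Prop :=
  HasSum (fun i : ℕ => (p i).toReal * (i : ℝ)) m

/-- The distribution `p` on `ℕ` has a finite moment of order `s`. -/
def HasFiniteMoment (p : PMF ℕ) (s : ℝ) : Prop :=
  Summable (fun i : ℕ => (p i).toReal * (i : ℝ) ^ s)

/-- `Z k / (ν * μ ^ (k - 1))` for `k ≥ 1`, indexed from `0`: the value at `k` is the one of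
generation `k + 1`. -/
noncomputable def normalizedSize {Ω : Type*} (Z : ℕ → Ω → ℕ) (ν μ : ℝ) (k : ℕ) (ω : Ω) : ℝ :=
  (Z (k + 1) ω : ℝ) / (ν * μ ^ k)

/-- `W = lim Z k / (ν * μ ^ (k - 1))` as `k → ∞` (arbitrary where the limit does not exist). -/
noncomputable def martingaleLimit {Ω : Type*} (Z : ℕ → Ω → ℕ) (ν μ : ℝ) (ω : Ω) : ℝ :=
  limUnder atTop (fun k => normalizedSize Z ν μ k ω)

/-! Write `X a = Z (a+1) / (ν μ^a)`. Given one generation, the next is a sum of independent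
offspring numbers; truncating them (`integral_abs_sum_sub_le`) turns the moment of order `1 + κ`
into a geometric bound on `E|X (a+1) - X a|`. So `X a → W` almost surely and in `L¹` at rate
`μ^(-κa/4)`, and `E W = 1` (`exists_seqLimit_bound`, `integral_seqLimit`).

The sum in the exponent is `ν² ∑_{j<k} μ^j X⁺_{⌈j/2⌉} X⁻_{⌊j/2⌋}`. By independence it equals `ν²
μ^k/(μ-1) W⁺W⁻` up to an `L¹` error of order `μ^(k(1-κ/8))`. Since `exp(-x)` is 1-Lipschitz on `x ≥
0`, this settles all `k` with `μ^k ≤ n^(1+β)`, `β = κ/8`.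

For larger `k`, compare with the last `l` such that `μ^l ≤ n^(1+β)` (`abs_exp_pairSum_sub_le`). Both
exponentials decrease in time. If both limits are positive, they differ at `k` by at most their
difference at `l` plus the second one at `l`, whose mean is small by the Laplace transform of `W` on
survival. If a limit vanishes, the second exponential is 1 and the first stops changing once a
process is extinct, so only late extinction costs anything.

Both costs decay geometrically (`exists_survival_rate`). For the process with one individual in
generation 1, the Laplace transform `φ` of `W` satisfies `φ(μs) = f(φ(s))`, with `f` the generating
function. Hence `φ(μ^k)` and the extinction probabilities are iterates of `f` from `φ(1)` and from
`0`; by convexity these contract towards the fixed point `P(W = 0) < φ(1)`. A general root law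
contributes one outer generating function, with Lipschitz constant `ν`. -/

/-! ### Moments of distributions on `ℕ` as integrals. -/

theorem PMF.integrable_of_summable {p : PMF ℕ} {h : ℕ → ℝ} (h0 : ∀ i, 0 ≤ h i)
    (hs : Summable fun i => (p i).toReal * h i) : Integrable h p.toMeasure := by
  refine ⟨(measurable_of_countable h).aestronglyMeasurable, ?_⟩
  rw [hasFiniteIntegral_iff_enorm, lintegral_countable']
  have : ∀ i, ‖h i‖ₑ * p.toMeasure {i} = ENNReal.ofReal ((p i).toReal * h i) := by
    intro i
    rw [PMF.toMeasure_apply_singleton _ _ (measurableSet_singleton i),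
      ENNReal.ofReal_mul ENNReal.toReal_nonneg, ENNReal.ofReal_toReal (p.apply_ne_top i),
      Real.enorm_of_nonneg (h0 i), mul_comm]
  simp_rw [this]
  rw [← ENNReal.ofReal_tsum_of_nonneg (fun i => mul_nonneg ENNReal.toReal_nonneg (h0 i)) hs]
  exact ENNReal.ofReal_lt_top

theorem HasMean.integrable {p : PMF ℕ} {m : ℝ} (h : HasMean p m) :
    Integrable (fun i : ℕ => (i : ℝ)) p.toMeasure :=
  PMF.integrable_of_summable (fun i => Nat.cast_nonneg i) h.summable

theorem HasMean.integral_eq {p : PMF ℕ} {m : ℝ} (h : HasMean p m) :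
    ∫ i, (i : ℝ) ∂p.toMeasure = m := by
  rw [PMF.integral_eq_tsum _ _ h.integrable]
  simpa [smul_eq_mul] using h.tsum_eq

theorem HasFiniteMoment.integrable {p : PMF ℕ} {s : ℝ} (h : HasFiniteMoment p s) :
    Integrable (fun i : ℕ => (i : ℝ) ^ s) p.toMeasure :=
  PMF.integrable_of_summable (fun i => Real.rpow_nonneg (Nat.cast_nonneg i) s) h

/-! ### A first-moment deviation bound by truncation. -/

/-- AM-GM with a free scale `l`: integrated, it bounds a first absolute moment affinely by a
variance, which can then be averaged over a random number of summands. -/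
theorem abs_le_add_sq_div {l : ℝ} (hl : 0 < l) (x : ℝ) : |x| ≤ (l + x ^ 2 / l) / 2 := by
  rw [← sq_abs x]
  have h := sq_nonneg (|x| - l)
  have : |x| ^ 2 / l * l = |x| ^ 2 := div_mul_cancel₀ _ hl.ne'
  have h2 : 2 * |x| * l ≤ (l + |x| ^ 2 / l) * l := by nlinarith
  have := le_of_mul_le_mul_right h2 hl
  linarith

/-- A first-moment deviation bound for sums of independent variables with a finite moment of order
`1 + κ`, obtained by truncation at level `t`. -/
theorem integral_abs_sum_sub_le {Ω : Type*} [MeasurableSpace Ω] {P : Measure Ω}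
    [IsProbabilityMeasure P] {Y : ℕ → Ω → ℝ} (hindep : iIndepFun Y P)
    (hmeas : ∀ i, Measurable (Y i)) (hnn : ∀ i ω, 0 ≤ Y i ω) {m M κ : ℝ}
    (hκ₀ : 0 < κ) (hκ₁ : κ ≤ 1) (hint : ∀ i, Integrable (Y i) P) (hmean : ∀ i, ∫ ω, Y i ω ∂P = m)
    (hmom : ∀ i, Integrable (fun ω => Y i ω ^ (1 + κ)) P)
    (hM : ∀ i, ∫ ω, Y i ω ^ (1 + κ) ∂P ≤ M) {t l : ℝ} (ht : 0 < t) (hl : 0 < l) (z : ℕ) :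
    ∫ ω, |∑ i ∈ Finset.range z, (Y i ω - m)| ∂P ≤
      (l + z * (t ^ (1 - κ) * M) / l) / 2 + 2 * (z * (t ^ (-κ) * M)) := by
  classical
  let T : ℝ → ℝ := fun y => if y ≤ t then y else 0
  have hTm : Measurable T := Measurable.ite measurableSet_Iic measurable_id measurable_const
  have hT0 : ∀ y, 0 ≤ y → 0 ≤ T y := by
    intro y hy; simp only [T]; split_ifs <;> simp [hy]
  have hTt : ∀ y, T y ≤ t := by
    intro y; simp only [T]; split_ifs with h
    · exact h
    · exact ht.le
  have hTy : ∀ y, 0 ≤ y → T y ≤ y := by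
    intro y hy; simp only [T]; split_ifs <;> simp [hy]
  -- Below the level, `y² = y^(1-κ) y^(1+κ)` with `y ≤ t`; here `κ ≤ 1` enters.
  have hT2 : ∀ y, 0 ≤ y → T y ^ 2 ≤ t ^ (1 - κ) * y ^ (1 + κ) := by
    intro y hy
    simp only [T]; split_ifs with h
    · rcases hy.eq_or_lt with rfl | hy
      · have := Real.rpow_nonneg ht.le (1 - κ)
        simp; positivity
      · have : y ^ 2 = y ^ (1 - κ) * y ^ (1 + κ) := by
          rw [← Real.rpow_add hy]; norm_num
        rw [this]
        gcongr
    · have := Real.rpow_nonneg hy (1 + κ)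
      have := Real.rpow_nonneg ht.le (1 - κ)
      simp; positivity
  have hTsub : ∀ y, 0 ≤ y → y - T y ≤ t ^ (-κ) * y ^ (1 + κ) := by
    intro y hy
    simp only [T]; split_ifs with h
    · have := Real.rpow_nonneg hy (1 + κ)
      have := Real.rpow_nonneg ht.le (-κ)
      simp; positivity
    · push Not at h
      rw [Real.rpow_add (by linarith), Real.rpow_one, Real.rpow_neg ht.le, sub_zero,
        inv_mul_eq_div, le_div_iff₀ (by positivity)]
      gcongr
  have hTmeas : ∀ i, Measurable fun ω => T (Y i ω) := fun i => hTm.comp (hmeas i)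
  have hTLp : ∀ i, MemLp (fun ω => T (Y i ω)) 2 P := fun i =>
    MemLp.of_bound (hTmeas i).aestronglyMeasurable t (ae_of_all _ fun ω => by
      rw [Real.norm_of_nonneg (hT0 _ (hnn i ω))]; exact hTt _)
  have hTint : ∀ i, Integrable (fun ω => T (Y i ω)) P := fun i => (hTLp i).integrable one_le_two
  set S : Ω → ℝ := ∑ i ∈ Finset.range z, fun ω => T (Y i ω) with hS
  have hSLp : MemLp S 2 P := memLp_finsetSum' _ fun i _ => hTLp i
  have hSint : ∫ ω, S ω ∂P = ∑ i ∈ Finset.range z, ∫ ω, T (Y i ω) ∂P := by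
    simp only [hS, Finset.sum_apply]
    exact integral_finsetSum _ fun i _ => hTint i
  have hvar : Var[S; P] ≤ z * (t ^ (1 - κ) * M) := by
    rw [hS, IndepFun.variance_sum (fun i _ => hTLp i)]
    · calc ∑ i ∈ Finset.range z, Var[fun ω => T (Y i ω); P]
          ≤ ∑ i ∈ Finset.range z, t ^ (1 - κ) * M := by
            refine Finset.sum_le_sum fun i _ => ?_
            refine (variance_le_expectation_sq (hTmeas i).aestronglyMeasurable).trans ?_
            calc ∫ ω, ((fun ω => T (Y i ω)) ^ 2) ω ∂P
                ≤ ∫ ω, t ^ (1 - κ) * Y i ω ^ (1 + κ) ∂P :=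
                  integral_mono (hTLp i).integrable_sq ((hmom i).const_mul _)
                    fun ω => hT2 _ (hnn i ω)
              _ ≤ t ^ (1 - κ) * M := by
                  rw [integral_const_mul]
                  exact mul_le_mul_of_nonneg_left (hM i) (Real.rpow_nonneg ht.le _)
        _ = _ := by simp
    · intro i _ j _ hij
      exact (hindep.indepFun hij).comp hTm hTm
  have hdev : ∫ ω, |S ω - ∫ ω', S ω' ∂P| ∂P ≤ (l + z * (t ^ (1 - κ) * M) / l) / 2 := by
    have hI : Integrable (fun ω => (S ω - ∫ ω', S ω' ∂P) ^ 2) P :=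
      (hSLp.sub (memLp_const _)).integrable_sq
    calc ∫ ω, |S ω - ∫ ω', S ω' ∂P| ∂P
        ≤ ∫ ω, (l + (S ω - ∫ ω', S ω' ∂P) ^ 2 / l) / 2 ∂P := by
          refine integral_mono ?_ ?_ fun ω => abs_le_add_sq_div hl _
          · exact ((hSLp.integrable one_le_two).sub (integrable_const _)).abs
          · exact ((integrable_const _).add (hI.div_const _)).div_const _
      _ = (l + Var[S; P] / l) / 2 := by
          rw [integral_div, integral_add (integrable_const _) (hI.div_const _), integral_div,
            variance_eq_integral hSLp.aestronglyMeasurable.aemeasurable]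
          simp
      _ ≤ _ := by gcongr
  have hrem : ∀ i, ∫ ω, (Y i ω - T (Y i ω)) ∂P ≤ t ^ (-κ) * M := by
    intro i
    calc ∫ ω, (Y i ω - T (Y i ω)) ∂P ≤ ∫ ω, t ^ (-κ) * Y i ω ^ (1 + κ) ∂P :=
          integral_mono ((hint i).sub (hTint i)) ((hmom i).const_mul _)
            fun ω => hTsub _ (hnn i ω)
      _ ≤ _ := by
          rw [integral_const_mul]
          exact mul_le_mul_of_nonneg_left (hM i) (Real.rpow_nonneg ht.le _)
  have hremsum : ∑ i ∈ Finset.range z, ∫ ω, (Y i ω - T (Y i ω)) ∂P ≤ z * (t ^ (-κ) * M) := by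
    refine (Finset.sum_le_sum fun i _ => hrem i).trans ?_
    simp
  -- Besides the deviation of the truncated sum there remain the removed part and its mean. Both are
  -- nonnegative with the same integral, whence the factor 2 in the bound.
  have hpt : ∀ ω, |∑ i ∈ Finset.range z, (Y i ω - m)| ≤ |S ω - ∫ ω', S ω' ∂P| +
      (∑ i ∈ Finset.range z, (Y i ω - T (Y i ω)) +
        ∑ i ∈ Finset.range z, ∫ ω', (Y i ω' - T (Y i ω')) ∂P) := by
    intro ω
    have h1 : ∑ i ∈ Finset.range z, ∫ ω', (Y i ω' - T (Y i ω')) ∂P =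
        z * m - ∫ ω', S ω' ∂P := by
      rw [hSint]
      simp_rw [fun i => integral_sub (hint i) (hTint i), hmean]
      simp
    have h2 : ∑ i ∈ Finset.range z, (Y i ω - T (Y i ω)) =
        ∑ i ∈ Finset.range z, Y i ω - S ω := by
      simp [hS]
    have h3 : 0 ≤ ∑ i ∈ Finset.range z, (Y i ω - T (Y i ω)) :=
      Finset.sum_nonneg fun i _ => sub_nonneg.2 (hTy _ (hnn i ω))
    have h4 : 0 ≤ ∑ i ∈ Finset.range z, ∫ ω', (Y i ω' - T (Y i ω')) ∂P :=
      Finset.sum_nonneg fun i _ => integral_nonneg fun ω' => sub_nonneg.2 (hTy _ (hnn i ω'))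
    have h5 : ∑ i ∈ Finset.range z, (Y i ω - m) = ∑ i ∈ Finset.range z, Y i ω - z * m := by
      simp
    rw [h5]
    rw [h2, h1] at *
    rw [abs_le]
    constructor
    · linarith [neg_abs_le (S ω - ∫ ω', S ω' ∂P)]
    · linarith [le_abs_self (S ω - ∫ ω', S ω' ∂P)]
  have hI1 : Integrable (fun ω => |S ω - ∫ ω', S ω' ∂P|) P :=
    ((hSLp.integrable one_le_two).sub (integrable_const _)).abs
  have hI2 : Integrable (fun ω => ∑ i ∈ Finset.range z, (Y i ω - T (Y i ω))) P :=
    integrable_finsetSum _ fun i _ => (hint i).sub (hTint i)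
  have hI2' : ∫ ω, ∑ i ∈ Finset.range z, (Y i ω - T (Y i ω)) ∂P =
      ∑ i ∈ Finset.range z, ∫ ω, (Y i ω - T (Y i ω)) ∂P :=
    integral_finsetSum _ fun i _ => (hint i).sub (hTint i)
  have hI3 : Integrable (fun ω => ∑ i ∈ Finset.range z, (Y i ω - T (Y i ω)) +
      ∑ i ∈ Finset.range z, ∫ ω', (Y i ω' - T (Y i ω')) ∂P) P := hI2.add (integrable_const _)
  calc ∫ ω, |∑ i ∈ Finset.range z, (Y i ω - m)| ∂P
      ≤ ∫ ω, (|S ω - ∫ ω', S ω' ∂P| + (∑ i ∈ Finset.range z, (Y i ω - T (Y i ω)) +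
        ∑ i ∈ Finset.range z, ∫ ω', (Y i ω' - T (Y i ω')) ∂P)) ∂P :=
        integral_mono
          (integrable_finsetSum _ fun i _ => (hint i).sub (integrable_const m)).abs
          (hI1.add hI3) hpt
    _ ≤ _ := by
        rw [integral_add hI1 hI3, integral_add hI2 (integrable_const _), hI2']
        simp only [integral_const, probReal_univ, one_smul]
        linarith

/-! ### Independence in the table of offspring numbers. -/

/-- The joint law of all offspring numbers of the delayed branching process. -/
noncomputable def offspringMeasure (g f : PMF ℕ) : Measure (ℕ × ℕ → ℕ) :=
  Measure.infinitePi fun p : ℕ × ℕ => (if p.1 = 0 then g else f).toMeasure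

instance (g f : PMF ℕ) : IsProbabilityMeasure (offspringMeasure g f) := by
  unfold offspringMeasure; infer_instance

theorem delayedBranchingLaw_eq_map (g f : PMF ℕ) :
    delayedBranchingLaw g f = (offspringMeasure g f).map generationSize := rfl

instance (g f : PMF ℕ) : IsProbabilityMeasure (delayedBranchingLaw g f) :=
  Measure.isProbabilityMeasure_map measurable_generationSize.aemeasurable

theorem hasLaw_offspring_zero (g f : PMF ℕ) (i : ℕ) :
    HasLaw (fun ξ : ℕ × ℕ → ℕ => ξ (0, i)) g.toMeasure (offspringMeasure g f) :=
  (measurePreserving_eval_infinitePi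
    (fun p : ℕ × ℕ => (if p.1 = 0 then g else f).toMeasure) (0, i)).hasLaw

theorem hasLaw_offspring_succ (g f : PMF ℕ) (k i : ℕ) :
    HasLaw (fun ξ : ℕ × ℕ → ℕ => ξ (k + 1, i)) f.toMeasure (offspringMeasure g f) :=
  (measurePreserving_eval_infinitePi
    (fun p : ℕ × ℕ => (if p.1 = 0 then g else f).toMeasure) (k + 1, i)).hasLaw

theorem iIndepFun_offspring (g f : PMF ℕ) :
    iIndepFun (fun (p : ℕ × ℕ) (ξ : ℕ × ℕ → ℕ) => ξ p) (offspringMeasure g f) :=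
  iIndepFun_infinitePi (X := fun _ x => x) fun _ => measurable_id

theorem iIndepFun_offspring_row (g f : PMF ℕ) (k : ℕ) :
    iIndepFun (fun (i : ℕ) (ξ : ℕ × ℕ → ℕ) => ξ (k, i)) (offspringMeasure g f) :=
  (iIndepFun_offspring g f).precomp (g := fun i : ℕ => (k, i)) fun i j h => by simpa using h

/-- The σ-algebra of a block of coordinates lies in the supremum of the σ-algebras of its members,
and suprema over disjoint index sets are independent. The blocks may be infinite. -/
theorem ProbabilityTheory.iIndepFun.indepFun_restrict {ι Ω α : Type*} [MeasurableSpace Ω]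
    [MeasurableSpace α] {P : Measure Ω} {X : ι → Ω → α} (h : iIndepFun X P)
    (hX : ∀ i, Measurable (X i)) {S T : Set ι} (hST : Disjoint S T) :
    IndepFun (fun ω (i : S) => X i ω) (fun ω (i : T) => X i ω) P := by
  have h1 := indep_iSup_of_disjoint (fun i => (hX i).comap_le) h.iIndep hST
  rw [IndepFun_iff_Indep]
  refine indep_of_indep_of_le_left (indep_of_indep_of_le_right h1 ?_) ?_ <;>
  · rw [← measurable_iff_comap_le, @measurable_pi_iff]
    rintro ⟨i, hi⟩
    rw [measurable_iff_comap_le]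
    exact le_iSup₂_of_le i hi le_rfl

theorem generationSize_congr {ξ η : ℕ × ℕ → ℕ} {k : ℕ} (h : ∀ j < k, ∀ i, ξ (j, i) = η (j, i)) :
    generationSize ξ k = generationSize η k := by
  induction k with
  | zero => rfl
  | succ k ih =>
    simp only [generationSize]
    rw [ih fun j hj => h j (hj.trans k.lt_succ_self)]
    exact Finset.sum_congr rfl fun i _ => h k k.lt_succ_self i

theorem measurable_generationSize_apply (k : ℕ) :
    Measurable fun ξ : ℕ × ℕ → ℕ => generationSize ξ k :=
  (measurable_pi_apply k).comp measurable_generationSize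

/-- The size of generation `k` is independent of the offspring numbers of its individuals. -/
theorem indepFun_generationSize_row (g f : PMF ℕ) (k : ℕ) :
    IndepFun (fun ξ => generationSize ξ k) (fun (ξ : ℕ × ℕ → ℕ) (i : ℕ) => ξ (k, i))
      (offspringMeasure g f) := by
  classical
  let S : Set (ℕ × ℕ) := {p | p.1 < k}
  let T : Set (ℕ × ℕ) := {p | p.1 = k}
  have hST : Disjoint S T := Set.disjoint_left.2 fun p hp hp' => by
    simp only [S, T, Set.mem_ofPred_eq] at hp hp'; omega
  have h := (iIndepFun_offspring g f).indepFun_restrict (fun p => measurable_pi_apply p) hST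
  -- The filling value 0 is irrelevant: generation `k` reads only rows below `k`.
  let E : (S → ℕ) → (ℕ × ℕ → ℕ) := fun x p => if hp : p ∈ S then x ⟨p, hp⟩ else 0
  have hE : Measurable E := by
    refine measurable_pi_lambda _ fun p => ?_
    by_cases hp : p ∈ S
    · simp only [E, hp, dif_pos]; exact measurable_pi_apply _
    · simp only [E, hp, dif_neg, not_false_eq_true]; exact measurable_const
  let R : (T → ℕ) → (ℕ → ℕ) := fun x i => x ⟨(k, i), rfl⟩
  have hR : Measurable R := measurable_pi_lambda _ fun i => measurable_pi_apply _
  have h2 := h.comp ((measurable_generationSize_apply k).comp hE) hR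
  have hEq : (fun ξ => generationSize ξ k) =
      ((fun ξ => generationSize ξ k) ∘ E) ∘ fun (ξ : ℕ × ℕ → ℕ) (p : S) => ξ p := by
    funext ξ
    refine generationSize_congr fun j hj i => ?_
    simp [E, S, hj]
  rw [hEq]
  exact h2

theorem map_generationSize_prod_row (g f : PMF ℕ) (k : ℕ) :
    (offspringMeasure g f).map (fun ξ => (generationSize ξ k, fun i : ℕ => ξ (k, i))) =
      ((offspringMeasure g f).map fun ξ => generationSize ξ k).prod
        ((offspringMeasure g f).map fun ξ i => ξ (k, i)) :=
  (indepFun_generationSize_row g f k).map_prod_eq_prod_map_map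
    (measurable_generationSize_apply k).aemeasurable
    (measurable_pi_lambda _ fun i => measurable_pi_apply (k, i)).aemeasurable

/-- Conditioning on the size of generation `k`. -/
theorem lintegral_generationSize_row (g f : PMF ℕ) (k : ℕ) (h : ℕ → (ℕ → ℕ) → ENNReal)
    (hh : ∀ z, Measurable (h z)) :
    ∫⁻ ξ, h (generationSize ξ k) (fun i => ξ (k, i)) ∂offspringMeasure g f =
      ∫⁻ η, ∫⁻ ξ, h (generationSize η k) (fun i => ξ (k, i)) ∂offspringMeasure g f
        ∂offspringMeasure g f := by
  have hm : Measurable fun p : ℕ × (ℕ → ℕ) => h p.1 p.2 :=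
    measurable_from_prod_countable_right hh
  have hrow : Measurable fun (ξ : ℕ × ℕ → ℕ) (i : ℕ) => ξ (k, i) := by fun_prop
  have hg := measurable_generationSize_apply k
  have h1 := lintegral_map (μ := offspringMeasure g f) hm (hg.prodMk hrow)
  rw [← h1, map_generationSize_prod_row, lintegral_prod _ hm.aemeasurable,
    lintegral_map (measurable_of_countable _) hg]
  refine lintegral_congr fun η => ?_
  exact lintegral_map (hh _) hrow

theorem generationSize_succ (ξ : ℕ × ℕ → ℕ) (k : ℕ) :
    generationSize ξ (k + 1) = ∑ i ∈ Finset.range (generationSize ξ k), ξ (k, i) := rfl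

theorem generationSize_one (ξ : ℕ × ℕ → ℕ) : generationSize ξ 1 = ξ (0, 0) := by
  simp [generationSize]

/-! ### Generating functions on the unit interval. -/

/-- The probability generating function of a distribution on `ℕ`. -/
noncomputable def pgf (p : PMF ℕ) (u : ℝ) : ℝ := ∫ i, u ^ i ∂p.toMeasure

theorem integrable_pow (p : PMF ℕ) {u : ℝ} (hu : u ∈ Set.Icc (0 : ℝ) 1) :
    Integrable (fun i : ℕ => u ^ i) p.toMeasure :=
  Integrable.of_bound (measurable_of_countable _).aestronglyMeasurable 1
    (ae_of_all _ fun i => by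
      rw [Real.norm_of_nonneg (pow_nonneg hu.1 i)]; exact pow_le_one₀ hu.1 hu.2)

theorem pgf_nonneg (p : PMF ℕ) {u : ℝ} (hu : 0 ≤ u) : 0 ≤ pgf p u :=
  integral_nonneg fun i => pow_nonneg hu i

theorem pgf_mono (p : PMF ℕ) {u v : ℝ} (hu : 0 ≤ u) (huv : u ≤ v) (hv : v ≤ 1) :
    pgf p u ≤ pgf p v :=
  integral_mono (integrable_pow p ⟨hu, huv.trans hv⟩) (integrable_pow p ⟨hu.trans huv, hv⟩)
    fun i => pow_le_pow_left₀ hu huv i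

theorem pgf_one (p : PMF ℕ) : pgf p 1 = 1 := by simp [pgf]

theorem pgf_mem_Icc (p : PMF ℕ) {u : ℝ} (hu : u ∈ Set.Icc (0 : ℝ) 1) :
    pgf p u ∈ Set.Icc (0 : ℝ) 1 :=
  ⟨pgf_nonneg p hu.1, (pgf_mono p hu.1 hu.2 le_rfl).trans_eq (pgf_one p)⟩

theorem pgf_iterate_mem_Icc (p : PMF ℕ) (k : ℕ) {u : ℝ} (hu : u ∈ Set.Icc (0 : ℝ) 1) :
    (pgf p)^[k] u ∈ Set.Icc (0 : ℝ) 1 :=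
  Set.MapsTo.iterate (s := Set.Icc (0 : ℝ) 1) (fun _ hv => pgf_mem_Icc p hv) k hu

theorem convexOn_pgf (p : PMF ℕ) : ConvexOn ℝ (Set.Icc 0 1) (pgf p) := by
  refine ⟨convex_Icc 0 1, fun x hx y hy a b ha hb hab => ?_⟩
  have hxy := convex_Icc (0 : ℝ) 1 hx hy ha hb hab
  simp only [smul_eq_mul] at hxy ⊢
  unfold pgf
  rw [← integral_const_mul, ← integral_const_mul,
    ← integral_add ((integrable_pow p hx).const_mul a) ((integrable_pow p hy).const_mul b)]
  refine integral_mono (integrable_pow p hxy)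
    (((integrable_pow p hx).const_mul a).add ((integrable_pow p hy).const_mul b)) fun i => ?_
  exact (convexOn_pow i).2 hx.1 hy.1 ha hb hab

theorem pow_sub_pow_le {u v : ℝ} (hu : 0 ≤ u) (huv : u ≤ v) (hv : v ≤ 1) (i : ℕ) :
    v ^ i - u ^ i ≤ i * (v - u) := by
  induction i with
  | zero => simp
  | succ i ih =>
    have h1 : v ^ (i + 1) - u ^ (i + 1) = v * (v ^ i - u ^ i) + u ^ i * (v - u) := by ring
    have h2 : 0 ≤ v ^ i - u ^ i := sub_nonneg.2 (pow_le_pow_left₀ hu huv i)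
    have h3 : u ^ i ≤ 1 := pow_le_one₀ hu (huv.trans hv)
    rw [h1]
    push_cast
    nlinarith

theorem pgf_sub_le {p : PMF ℕ} {m : ℝ} (hp : HasMean p m) {u v : ℝ} (hu : 0 ≤ u) (huv : u ≤ v)
    (hv : v ≤ 1) : pgf p v - pgf p u ≤ m * (v - u) := by
  have hu' : u ∈ Set.Icc (0 : ℝ) 1 := ⟨hu, huv.trans hv⟩
  have hv' : v ∈ Set.Icc (0 : ℝ) 1 := ⟨hu.trans huv, hv⟩
  unfold pgf
  rw [← integral_sub (integrable_pow p hv') (integrable_pow p hu'), ← hp.integral_eq,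
    ← integral_mul_const]
  exact integral_mono ((integrable_pow p hv').sub (integrable_pow p hu'))
    (hp.integrable.mul_const _) fun i => pow_sub_pow_le hu huv hv i

theorem abs_pgf_sub_le {p : PMF ℕ} {m : ℝ} (hp : HasMean p m) {u v : ℝ}
    (hu : u ∈ Set.Icc (0 : ℝ) 1) (hv : v ∈ Set.Icc (0 : ℝ) 1) :
    |pgf p u - pgf p v| ≤ m * |u - v| := by
  rcases le_total u v with h | h
  · rw [abs_sub_comm, abs_sub_comm u v, abs_of_nonneg (sub_nonneg.2 h),
      abs_of_nonneg (sub_nonneg.2 (pgf_mono p hu.1 h hv.2))]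
    exact pgf_sub_le hp hu.1 h hv.2
  · rw [abs_of_nonneg (sub_nonneg.2 h), abs_of_nonneg (sub_nonneg.2 (pgf_mono p hv.1 h hu.2))]
    exact pgf_sub_le hp hv.1 h hu.2

theorem continuousOn_pgf {p : PMF ℕ} {m : ℝ} (hp : HasMean p m) :
    ContinuousOn (pgf p) (Set.Icc 0 1) := by
  have hm : 0 ≤ m := by rw [← hp.integral_eq]; exact integral_nonneg fun i => Nat.cast_nonneg i
  exact LipschitzOnWith.continuousOn (K := ⟨m, hm⟩) <| LipschitzOnWith.of_dist_le_mul
    fun u hu v hv => abs_pgf_sub_le hp hu hv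

/-! ### Moments and generating functions of one generation, by conditioning on the previous one. -/

section Row

variable (g : PMF ℕ) {f : PMF ℕ} {μ : ℝ}

theorem lintegral_cast_offspring (hf : HasMean f μ) (k i : ℕ) :
    ∫⁻ ξ, (ξ (k + 1, i) : ENNReal) ∂offspringMeasure g f = ENNReal.ofReal μ := by
  have h := (hasLaw_offspring_succ g f k i).lintegral_comp (f := fun x : ℕ => (x : ENNReal))
    (measurable_of_countable _).aemeasurable
  rw [h, ← hf.integral_eq, ofReal_integral_eq_lintegral_ofReal hf.integrable
    (ae_of_all _ fun i => Nat.cast_nonneg i)]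
  simp

theorem measurable_cast_generationSize (k : ℕ) :
    Measurable fun ξ : ℕ × ℕ → ℕ => (generationSize ξ k : ENNReal) :=
  (measurable_of_countable fun x : ℕ => (x : ENNReal)).comp (measurable_generationSize_apply k)

theorem lintegral_generationSize {g : PMF ℕ} {ν : ℝ} (hg : HasMean g ν) (hf : HasMean f μ)
    (hν : 0 ≤ ν) (k : ℕ) :
    ∫⁻ ξ, (generationSize ξ (k + 1) : ENNReal) ∂offspringMeasure g f =
      ENNReal.ofReal (ν * μ ^ k) := by
  have hμ : 0 ≤ μ := by rw [← hf.integral_eq]; exact integral_nonneg fun i => Nat.cast_nonneg i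
  induction k with
  | zero =>
    have h := (hasLaw_offspring_zero g f 0).lintegral_comp (f := fun x : ℕ => (x : ENNReal))
      (measurable_of_countable _).aemeasurable
    simp only [zero_add, generationSize_one]
    rw [h, pow_zero, mul_one, ← hg.integral_eq, ofReal_integral_eq_lintegral_ofReal hg.integrable
      (ae_of_all _ fun i => Nat.cast_nonneg i)]
    simp
  | succ k ih =>
    simp_rw [generationSize_succ _ (k + 1)]
    push_cast
    rw [lintegral_generationSize_row g f (k + 1) (fun z x => ∑ i ∈ Finset.range z, (x i : ENNReal))
      fun z => Finset.measurable_sum _ fun i _ =>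
        (measurable_of_countable _).comp (measurable_pi_apply i)]
    have : ∀ z : ℕ, ∫⁻ ξ, ∑ i ∈ Finset.range z, (ξ (k + 1, i) : ENNReal) ∂offspringMeasure g f =
        z * ENNReal.ofReal μ := by
      intro z
      have hm : ∀ i ∈ Finset.range z, Measurable fun ξ : ℕ × ℕ → ℕ => (ξ (k + 1, i) : ENNReal) :=
        fun i _ => (measurable_of_countable fun x : ℕ => (x : ENNReal)).comp
          (measurable_pi_apply (k + 1, i))
      rw [lintegral_finsetSum _ hm]
      simp [lintegral_cast_offspring g hf]
    simp_rw [this]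
    rw [lintegral_mul_const _ (measurable_cast_generationSize (k + 1)), ih,
      ← ENNReal.ofReal_mul (by positivity), pow_succ, mul_assoc]

/-- Given `z` individuals in generation `k + 1`, the difference is a sum of `z` centred independent
offspring numbers. The truncation bound is affine in `z`, so averaging only needs the mean `ν μ^k`.
Both `t` and `l` stay free to be tuned to `k`. -/
theorem lintegral_abs_sub_generationSize_le {g : PMF ℕ} {ν κ : ℝ} (hg : HasMean g ν)
    (hf : HasMean f μ) (hν : 0 ≤ ν) (hκ₀ : 0 < κ) (hκ₁ : κ ≤ 1)
    (hfκ : HasFiniteMoment f (1 + κ)) {t l : ℝ} (ht : 0 < t) (hl : 0 < l) (k : ℕ) :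
    ∫⁻ ξ, ENNReal.ofReal |(generationSize ξ (k + 2) : ℝ) - μ * generationSize ξ (k + 1)|
        ∂offspringMeasure g f ≤
      ENNReal.ofReal (l / 2 + (ν * μ ^ k) * ((t ^ (1 - κ) / l / 2 + 2 * t ^ (-κ)) *
        ∫ i, (i : ℝ) ^ (1 + κ) ∂f.toMeasure)) := by
  have hμ : 0 ≤ μ := by rw [← hf.integral_eq]; exact integral_nonneg fun i => Nat.cast_nonneg i
  set M := ∫ i, (i : ℝ) ^ (1 + κ) ∂f.toMeasure with hM
  have hM0 : 0 ≤ M := integral_nonneg fun i => Real.rpow_nonneg (Nat.cast_nonneg i) _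
  set c := (t ^ (1 - κ) / l / 2 + 2 * t ^ (-κ)) * M with hc
  have hc0 : 0 ≤ c := by
    have := Real.rpow_nonneg ht.le (1 - κ)
    have := Real.rpow_nonneg ht.le (-κ)
    positivity
  let Y : ℕ → (ℕ × ℕ → ℕ) → ℝ := fun i ξ => (ξ (k + 1, i) : ℝ)
  have hYm : ∀ i, Measurable (Y i) := fun i =>
    (measurable_of_countable fun x : ℕ => (x : ℝ)).comp (measurable_pi_apply _)
  have hYi : iIndepFun Y (offspringMeasure g f) :=
    (iIndepFun_offspring_row g f (k + 1)).comp (fun _ (x : ℕ) => (x : ℝ))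
      fun _ => measurable_of_countable _
  have hlaw := hasLaw_offspring_succ g f k
  have hint : ∀ i, Integrable (Y i) (offspringMeasure g f) := fun i => by
    have := (hlaw i).map_eq ▸ hf.integrable
    exact this.comp_aemeasurable (hlaw i).aemeasurable
  have hmom : ∀ i, Integrable (fun ξ => Y i ξ ^ (1 + κ)) (offspringMeasure g f) := fun i => by
    have := (hlaw i).map_eq ▸ hfκ.integrable
    exact this.comp_aemeasurable (hlaw i).aemeasurable
  have hrow : ∀ z : ℕ, ∫⁻ ξ, ENNReal.ofReal |∑ i ∈ Finset.range z, ((ξ (k + 1, i) : ℝ) - μ)|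
      ∂offspringMeasure g f ≤ ENNReal.ofReal (l / 2) + z * ENNReal.ofReal c := by
    intro z
    have hI : Integrable (fun ξ : ℕ × ℕ → ℕ => ∑ i ∈ Finset.range z, ((ξ (k + 1, i) : ℝ) - μ))
        (offspringMeasure g f) :=
      integrable_finsetSum _ fun i _ => (hint i).sub (integrable_const μ)
    rw [← ofReal_integral_eq_lintegral_ofReal hI.abs
      (ae_of_all _ fun _ => abs_nonneg _), ← ENNReal.ofReal_natCast,
      ← ENNReal.ofReal_mul (Nat.cast_nonneg z), ← ENNReal.ofReal_add (by positivity)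
        (by positivity)]
    refine ENNReal.ofReal_le_ofReal ?_
    refine (integral_abs_sum_sub_le hYi hYm (fun _ _ => Nat.cast_nonneg _) hκ₀ hκ₁ hint
      (m := μ) ?_ hmom (M := M) ?_ ht hl z).trans_eq ?_
    · intro i
      have := (hlaw i).integral_comp (f := fun x : ℕ => (x : ℝ))
        (measurable_of_countable _).aestronglyMeasurable
      rw [hf.integral_eq] at this
      exact this
    · intro i
      exact ((hlaw i).integral_comp (f := fun x : ℕ => (x : ℝ) ^ (1 + κ))
        (measurable_of_countable _).aestronglyMeasurable).le
    · rw [hc]; ring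
  have hexp : ∀ ξ : ℕ × ℕ → ℕ,
      ENNReal.ofReal |(generationSize ξ (k + 2) : ℝ) - μ * generationSize ξ (k + 1)| =
      ENNReal.ofReal |∑ i ∈ Finset.range (generationSize ξ (k + 1)), ((ξ (k + 1, i) : ℝ) - μ)| := by
    intro ξ
    rw [generationSize_succ ξ (k + 1), Finset.sum_sub_distrib]
    simp [mul_comm]
  simp_rw [hexp]
  rw [lintegral_generationSize_row g f (k + 1)
    (fun z x => ENNReal.ofReal |∑ i ∈ Finset.range z, ((x i : ℝ) - μ)|)]
  · refine (lintegral_mono fun η => hrow _).trans_eq ?_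
    rw [lintegral_add_left measurable_const, lintegral_mul_const _ (measurable_cast_generationSize (k + 1)),
      lintegral_generationSize hg hf hν, ← ENNReal.ofReal_mul (by positivity)]
    simp only [lintegral_const, measure_univ, mul_one]
    rw [← ENNReal.ofReal_add (by positivity) (by positivity)]
  · intro z
    fun_prop

/-- Conditioning peels off the last generation and replaces `u` by `pgf f u`, so the induction runs
with `u` arbitrary. -/
theorem lintegral_pow_generationSize (f : PMF ℕ) {u : ℝ} (hu : u ∈ Set.Icc (0 : ℝ) 1) (k : ℕ) :
    ∫⁻ ξ, ENNReal.ofReal (u ^ generationSize ξ (k + 1)) ∂offspringMeasure g f =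
      ENNReal.ofReal (pgf g ((pgf f)^[k] u)) := by
  have hlin : ∀ p : PMF ℕ, ∀ v ∈ Set.Icc (0 : ℝ) 1,
      ∫⁻ i, ENNReal.ofReal (v ^ i) ∂p.toMeasure = ENNReal.ofReal (pgf p v) := fun p v hv =>
    (ofReal_integral_eq_lintegral_ofReal (integrable_pow p hv)
      (ae_of_all _ fun i => pow_nonneg hv.1 i)).symm
  induction k generalizing u with
  | zero =>
    have h := (hasLaw_offspring_zero g f 0).lintegral_comp
      (f := fun x : ℕ => ENNReal.ofReal (u ^ x)) (measurable_of_countable _).aemeasurable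
    simp only [zero_add, generationSize_one]
    rw [h, hlin g u hu, Function.iterate_zero, id]
  | succ k ih =>
    rw [Function.iterate_succ_apply, ← ih (pgf_mem_Icc f hu)]
    simp_rw [generationSize_succ _ (k + 1)]
    rw [lintegral_generationSize_row g f (k + 1)
      (fun z x => ENNReal.ofReal (u ^ ∑ i ∈ Finset.range z, x i))]
    · refine lintegral_congr fun η => ?_
      generalize generationSize η (k + 1) = z
      simp_rw [← Finset.prod_pow_eq_pow_sum, ENNReal.ofReal_prod_of_nonneg
        fun i (_ : i ∈ Finset.range z) => pow_nonneg hu.1 _]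
      have hi := (iIndepFun_offspring_row g f (k + 1)).comp
        (fun _ (x : ℕ) => ENNReal.ofReal (u ^ x)) fun _ => measurable_of_countable _
      have hm : ∀ i, Measurable ((fun x : ℕ => ENNReal.ofReal (u ^ x)) ∘
          fun ξ : ℕ × ℕ → ℕ => ξ (k + 1, i)) := fun i =>
        (measurable_of_countable _).comp (measurable_pi_apply (k + 1, i))
      refine (lintegral_prod_eq_prod_lintegral_of_indepFun (Finset.range z) _ hi hm).trans ?_
      have h1 : ∀ i, ∫⁻ ξ, ((fun x : ℕ => ENNReal.ofReal (u ^ x)) ∘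
          fun ξ : ℕ × ℕ → ℕ => ξ (k + 1, i)) ξ ∂offspringMeasure g f =
          ENNReal.ofReal (pgf f u) := fun i => by
        rw [← hlin f u hu]
        exact (hasLaw_offspring_succ g f k i).lintegral_comp
          (f := fun x : ℕ => ENNReal.ofReal (u ^ x)) (measurable_of_countable _).aemeasurable
      simp_rw [h1]
      rw [Finset.prod_const, Finset.card_range, ENNReal.ofReal_pow (pgf_nonneg f hu.1)]
    · intro z
      exact (measurable_of_countable fun x : ℕ => ENNReal.ofReal (u ^ x)).comp
        (Finset.measurable_sum _ fun i _ => measurable_pi_apply i)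

end Row

/-! ### Almost sure and `L¹` convergence to the martingale limit. -/

/-- The total variation of the path has finite mean, hence is almost surely finite and the path is
Cauchy. The distance to the limit is at most the tail of the increments, a geometric series in mean.
-/
theorem ae_tendsto_limUnder_of_lintegral_edist_le {Ω : Type*} [MeasurableSpace Ω] {P : Measure Ω}
    {u : ℕ → Ω → ℝ} (hu : ∀ a, Measurable (u a)) {K ρ : ℝ} (hK : 0 ≤ K) (hρ₀ : 0 ≤ ρ) (hρ₁ : ρ < 1)
    (h : ∀ a, ∫⁻ x, edist (u a x) (u (a + 1) x) ∂P ≤ ENNReal.ofReal (K * ρ ^ a)) :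
    (∀ᵐ x ∂P, Tendsto (fun a => u a x) atTop (𝓝 (limUnder atTop fun a => u a x))) ∧
    ∀ a, ∫⁻ x, edist (u a x) (limUnder atTop fun a => u a x) ∂P ≤
      ENNReal.ofReal (K / (1 - ρ) * ρ ^ a) := by
  have hm : ∀ a, Measurable fun x => edist (u a x) (u (a + 1) x) := fun a =>
    (hu a).edist (hu (a + 1))
  have hsum : ∀ a, ∑' j, ENNReal.ofReal (K * ρ ^ (a + j)) =
      ENNReal.ofReal (K / (1 - ρ) * ρ ^ a) := by
    intro a
    have hs : HasSum (fun j => K * ρ ^ (a + j)) (K / (1 - ρ) * ρ ^ a) := by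
      have := (hasSum_geometric_of_lt_one hρ₀ hρ₁).mul_left (K * ρ ^ a)
      simp only [mul_assoc, ← pow_add] at this
      have e : K / (1 - ρ) * ρ ^ a = K * (ρ ^ a * (1 - ρ)⁻¹) := by
        rw [div_eq_mul_inv]; ring
      rw [e]
      exact this
    rw [← ENNReal.ofReal_tsum_of_nonneg (fun j => by positivity) hs.summable, hs.tsum_eq]
  have hsum' : ∀ a, ∫⁻ x, ∑' j, edist (u (a + j) x) (u (a + j + 1) x) ∂P ≤
      ENNReal.ofReal (K / (1 - ρ) * ρ ^ a) := by
    intro a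
    rw [lintegral_tsum fun j => (hm (a + j)).aemeasurable, ← hsum a]
    exact ENNReal.tsum_le_tsum fun j => h (a + j)
  have hconv : ∀ᵐ x ∂P, Tendsto (fun a => u a x) atTop (𝓝 (limUnder atTop fun a => u a x)) := by
    have h0 := ae_lt_top (Measurable.tsum fun j => hm (0 + j))
      ((hsum' 0).trans_lt ENNReal.ofReal_lt_top).ne
    filter_upwards [h0] with x hx
    simp only [zero_add] at hx
    exact (cauchySeq_of_edist_le_of_tsum_ne_top _ (fun _ => le_rfl) hx.ne).tendsto_limUnder
  refine ⟨hconv, fun a => le_trans (lintegral_mono_ae ?_) (hsum' a)⟩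
  filter_upwards [hconv] with x hx
  exact edist_le_tsum_of_edist_le_of_tendsto _ (fun _ => le_rfl) hx a

/-- The normalized generation sizes `x (a + 1) / (ν * μ ^ a)` of a sequence `x`. -/
noncomputable def seqNormalized (ν μ : ℝ) (a : ℕ) (x : ℕ → ℕ) : ℝ := (x (a + 1) : ℝ) / (ν * μ ^ a)

/-- The limit of the normalized generation sizes of a sequence. -/
noncomputable def seqLimit (ν μ : ℝ) (x : ℕ → ℕ) : ℝ :=
  limUnder atTop fun a => seqNormalized ν μ a x

theorem measurable_seqNormalized (ν μ : ℝ) (a : ℕ) : Measurable (seqNormalized ν μ a) := by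
  unfold seqNormalized
  exact ((measurable_of_countable fun x : ℕ => (x : ℝ)).comp
    (measurable_pi_apply (a + 1))).div_const _

theorem measurable_seqLimit (ν μ : ℝ) : Measurable (seqLimit ν μ) :=
  (StronglyMeasurable.limUnder (l := atTop) fun a =>
    (measurable_seqNormalized ν μ a).stronglyMeasurable).measurable

theorem seqNormalized_nonneg {ν μ : ℝ} (hν : 0 < ν) (hμ : 1 < μ) (a : ℕ) (x : ℕ → ℕ) :
    0 ≤ seqNormalized ν μ a x := by
  unfold seqNormalized; positivity

section Law

variable {g f : PMF ℕ} {μ ν κ : ℝ}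

theorem ae_delayedBranchingLaw_absorbing (g f : PMF ℕ) :
    ∀ᵐ x ∂delayedBranchingLaw g f, ∀ k j : ℕ, k ≤ j → x k = 0 → x j = 0 := by
  rw [ae_all_iff]; intro k
  rw [ae_all_iff]; intro j
  rw [delayedBranchingLaw_eq_map, ae_map_iff measurable_generationSize.aemeasurable]
  · refine ae_of_all _ fun ξ hkj h => ?_
    induction j, hkj using Nat.le_induction with
    | base => exact h
    | succ j _ ih => simp [generationSize_succ, ih]
  · have hm : Measurable fun x : ℕ → ℕ => (x k, x j) :=
      (measurable_pi_apply k).prodMk (measurable_pi_apply j)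
    exact hm (MeasurableSet.of_discrete (s := {p : ℕ × ℕ | k ≤ j → p.1 = 0 → p.2 = 0}))

theorem lintegral_cast_delayedBranchingLaw (hg : HasMean g ν) (hf : HasMean f μ) (hν : 0 ≤ ν)
    (k : ℕ) : ∫⁻ x, (x (k + 1) : ENNReal) ∂delayedBranchingLaw g f =
      ENNReal.ofReal (ν * μ ^ k) := by
  rw [delayedBranchingLaw_eq_map, lintegral_map _ measurable_generationSize]
  · exact lintegral_generationSize hg hf hν k
  · exact (measurable_of_countable fun x : ℕ => (x : ENNReal)).comp (measurable_pi_apply _)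

theorem integrable_seqNormalized (hg : HasMean g ν) (hf : HasMean f μ) (hν : 0 < ν) (hμ : 1 < μ)
    (a : ℕ) : Integrable (seqNormalized ν μ a) (delayedBranchingLaw g f) ∧
      ∫ x, seqNormalized ν μ a x ∂delayedBranchingLaw g f = 1 := by
  have hm := measurable_seqNormalized ν μ a
  have h : ∫⁻ x, ENNReal.ofReal (seqNormalized ν μ a x) ∂delayedBranchingLaw g f = 1 := by
    have hpos : 0 < ν * μ ^ a := by positivity
    have hm' : Measurable fun x : ℕ → ℕ => (x (a + 1) : ENNReal) :=
      (measurable_of_countable fun x : ℕ => (x : ENNReal)).comp (measurable_pi_apply (a + 1))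
    simp only [seqNormalized, ENNReal.ofReal_div_of_pos hpos, ENNReal.ofReal_natCast]
    simp only [div_eq_mul_inv]
    rw [lintegral_mul_const _ hm', lintegral_cast_delayedBranchingLaw hg hf hν.le]
    exact ENNReal.mul_inv_cancel (by simpa using hpos) ENNReal.ofReal_ne_top
  constructor
  · refine ⟨hm.aestronglyMeasurable, ?_⟩
    rw [hasFiniteIntegral_iff_ofReal (ae_of_all _ fun x => seqNormalized_nonneg hν hμ a x), h]
    exact ENNReal.one_lt_top
  · rw [integral_eq_lintegral_of_nonneg_ae (ae_of_all _ fun x => seqNormalized_nonneg hν hμ a x)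
      hm.aestronglyMeasurable, h, ENNReal.toReal_one]

theorem integral_pow_delayedBranchingLaw (g f : PMF ℕ) {u : ℝ} (hu : u ∈ Set.Icc (0 : ℝ) 1)
    (k : ℕ) : ∫ x, u ^ x (k + 1) ∂delayedBranchingLaw g f = pgf g ((pgf f)^[k] u) := by
  have hm : Measurable fun x : ℕ → ℕ => u ^ x (k + 1) :=
    (measurable_of_countable fun i : ℕ => u ^ i).comp (measurable_pi_apply _)
  rw [integral_eq_lintegral_of_nonneg_ae (ae_of_all _ fun x => pow_nonneg hu.1 _)
    hm.aestronglyMeasurable, delayedBranchingLaw_eq_map,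
    lintegral_map hm.ennreal_ofReal measurable_generationSize,
    lintegral_pow_generationSize g f hu k,
    ENNReal.toReal_ofReal (pgf_nonneg g (pgf_iterate_mem_Icc f k hu).1)]

theorem exists_lintegral_edist_seqNormalized_le (hg : HasMean g ν) (hf : HasMean f μ)
    (hν : 0 < ν) (hμ : 1 < μ) (hκ₀ : 0 < κ) (hκ₁ : κ ≤ 1) (hfκ : HasFiniteMoment f (1 + κ)) :
    ∃ K : ℝ, 0 ≤ K ∧ ∀ a, ∫⁻ x, edist (seqNormalized ν μ a x) (seqNormalized ν μ (a + 1) x)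
      ∂delayedBranchingLaw g f ≤ ENNReal.ofReal (K * (μ ^ (-(κ / 4))) ^ a) := by
  set M := ∫ i, (i : ℝ) ^ (1 + κ) ∂f.toMeasure with hM
  have hM0 : 0 ≤ M := integral_nonneg fun i => Real.rpow_nonneg (Nat.cast_nonneg i) _
  refine ⟨(1 / ν + 3 * M) / μ, by positivity, fun a => ?_⟩
  have hμ0 : 0 < μ := by linarith
  have hy : 1 ≤ μ ^ a := one_le_pow₀ hμ.le
  have hρ : (μ ^ (-(κ / 4))) ^ a = (μ ^ a) ^ (-(κ / 4)) := by
    rw [← Real.rpow_mul_natCast hμ0.le, ← Real.rpow_natCast_mul hμ0.le, mul_comm]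
  rw [hρ]
  have hpos : 0 < ν * μ ^ (a + 1) := by positivity
  have hed : ∀ ξ : ℕ × ℕ → ℕ, edist (seqNormalized ν μ a (generationSize ξ))
      (seqNormalized ν μ (a + 1) (generationSize ξ)) =
      ENNReal.ofReal |(generationSize ξ (a + 2) : ℝ) - μ * generationSize ξ (a + 1)| *
        (ENNReal.ofReal (ν * μ ^ (a + 1)))⁻¹ := by
    intro ξ
    rw [← div_eq_mul_inv, ← ENNReal.ofReal_div_of_pos hpos, edist_dist, dist_comm, Real.dist_eq]
    congr 1
    rw [← abs_of_pos hpos, ← abs_div]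
    congr 1
    unfold seqNormalized
    field_simp
    ring
  rw [delayedBranchingLaw_eq_map, lintegral_map
    ((measurable_seqNormalized ν μ a).edist (measurable_seqNormalized ν μ (a + 1)))
    measurable_generationSize]
  simp_rw [hed]
  rw [lintegral_mul_const']
  swap
  · simpa using hpos
  rw [← div_eq_mul_inv]
  refine ENNReal.div_le_of_le_mul ?_
  rw [← ENNReal.ofReal_mul' hpos.le]
  generalize hyd : μ ^ a = y at *
  have hy0 : 0 < y := by linarith
  -- With `y = μ^a`, the choices `t = y^(1/2)` and `l = y^(1-κ/4)` make `l/y`, `t^(1-κ)/l` and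
  -- `t^(-κ)` all at most `y^(-κ/4)`. The rate is not optimized.
  refine (lintegral_abs_sub_generationSize_le hg hf hν.le hκ₀ hκ₁ hfκ
    (t := y ^ (1 / 2 : ℝ)) (l := y ^ (1 - κ / 4)) (by positivity) (by positivity) a).trans ?_
  refine ENNReal.ofReal_le_ofReal ?_
  rw [hyd, ← hM, pow_succ, hyd]
  have e1 : y ^ (1 - κ / 4) = y * y ^ (-(κ / 4)) := by
    rw [sub_eq_add_neg, Real.rpow_add hy0, Real.rpow_one]
  have e2 : (y ^ (1 / 2 : ℝ)) ^ (1 - κ) / y ^ (1 - κ / 4) ≤ y ^ (-(κ / 4)) := by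
    rw [← Real.rpow_mul hy0.le, ← Real.rpow_sub hy0]
    exact Real.rpow_le_rpow_of_exponent_le hy (by linarith)
  have e3 : (y ^ (1 / 2 : ℝ)) ^ (-κ) ≤ y ^ (-(κ / 4)) := by
    rw [← Real.rpow_mul hy0.le]
    exact Real.rpow_le_rpow_of_exponent_le hy (by linarith)
  have e4 : 0 < y ^ (-(κ / 4)) := by positivity
  calc y ^ (1 - κ / 4) / 2 + ν * y * (((y ^ (1 / 2 : ℝ)) ^ (1 - κ) / y ^ (1 - κ / 4) / 2 +
        2 * (y ^ (1 / 2 : ℝ)) ^ (-κ)) * M)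
      ≤ y * y ^ (-(κ / 4)) + ν * y * ((y ^ (-(κ / 4)) + 2 * y ^ (-(κ / 4))) * M) := by
        gcongr
        · rw [e1]; linarith [mul_pos hy0 e4]
        · refine le_trans ?_ e2
          have : 0 ≤ (y ^ (1 / 2 : ℝ)) ^ (1 - κ) / y ^ (1 - κ / 4) := by positivity
          linarith
    _ = (1 / ν + 3 * M) / μ * y ^ (-(κ / 4)) * (ν * (y * μ)) := by
        field_simp
        ring

/-- Almost sure and geometrically fast `L¹` convergence of the normalized generation sizes. -/
theorem exists_seqLimit_bound (hg : HasMean g ν) (hf : HasMean f μ)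
    (hν : 0 < ν) (hμ : 1 < μ) (hκ₀ : 0 < κ) (hκ₁ : κ ≤ 1) (hfκ : HasFiniteMoment f (1 + κ)) :
    (∀ᵐ x ∂delayedBranchingLaw g f,
      Tendsto (fun a => seqNormalized ν μ a x) atTop (𝓝 (seqLimit ν μ x))) ∧
    Integrable (seqLimit ν μ) (delayedBranchingLaw g f) ∧
    ∃ K : ℝ, 0 ≤ K ∧ ∀ a, ∫ x, |seqNormalized ν μ a x - seqLimit ν μ x|
      ∂delayedBranchingLaw g f ≤ K * (μ ^ (-(κ / 4))) ^ a := by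
  obtain ⟨K, hK, h⟩ := exists_lintegral_edist_seqNormalized_le hg hf hν hμ hκ₀ hκ₁ hfκ
  have hρ₁ : μ ^ (-(κ / 4)) < 1 := Real.rpow_lt_one_of_one_lt_of_neg hμ (by linarith)
  have hρ₀ : 0 ≤ μ ^ (-(κ / 4)) := Real.rpow_nonneg (by linarith) _
  obtain ⟨h1, h2⟩ := ae_tendsto_limUnder_of_lintegral_edist_le (measurable_seqNormalized ν μ)
    hK hρ₀ hρ₁ h
  have hmd : ∀ a, Measurable fun x => seqNormalized ν μ a x - seqLimit ν μ x := fun a =>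
    (measurable_seqNormalized ν μ a).sub (measurable_seqLimit ν μ)
  have hbd : 0 ≤ K / (1 - μ ^ (-(κ / 4))) := div_nonneg hK (by linarith)
  have h3 : ∀ a, ∫⁻ x, ENNReal.ofReal |seqNormalized ν μ a x - seqLimit ν μ x|
      ∂delayedBranchingLaw g f ≤
      ENNReal.ofReal (K / (1 - μ ^ (-(κ / 4))) * (μ ^ (-(κ / 4))) ^ a) := by
    intro a
    refine le_trans (le_of_eq (lintegral_congr fun x => ?_)) (h2 a)
    rw [edist_dist, Real.dist_eq]
    rfl
  have hint : ∀ a, Integrable (fun x => seqNormalized ν μ a x - seqLimit ν μ x)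
      (delayedBranchingLaw g f) := by
    intro a
    refine ⟨(hmd a).aestronglyMeasurable, ?_⟩
    rw [hasFiniteIntegral_iff_norm]
    exact (h3 a).trans_lt ENNReal.ofReal_lt_top
  refine ⟨h1, ?_, _, hbd, fun a => ?_⟩
  · have := (integrable_seqNormalized hg hf hν hμ 0).1.sub (hint 0)
    refine this.congr (ae_of_all _ fun x => ?_)
    simp
  · rw [integral_eq_lintegral_of_nonneg_ae (ae_of_all _ fun x => abs_nonneg _)
      (hmd a).abs.aestronglyMeasurable]
    exact ENNReal.toReal_le_of_le_ofReal (by positivity) (h3 a)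

theorem ae_seqLimit_nonneg (hg : HasMean g ν) (hf : HasMean f μ)
    (hν : 0 < ν) (hμ : 1 < μ) (hκ₀ : 0 < κ) (hκ₁ : κ ≤ 1) (hfκ : HasFiniteMoment f (1 + κ)) :
    ∀ᵐ x ∂delayedBranchingLaw g f, 0 ≤ seqLimit ν μ x := by
  filter_upwards [(exists_seqLimit_bound hg hf hν hμ hκ₀ hκ₁ hfκ).1] with x hx
  exact ge_of_tendsto' hx fun a => seqNormalized_nonneg hν hμ a x

/-- Means pass to `L¹` limits. In particular the limit is not almost surely zero, which drives the
strict inequalities for the Laplace transform. -/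
theorem integral_seqLimit (hg : HasMean g ν) (hf : HasMean f μ)
    (hν : 0 < ν) (hμ : 1 < μ) (hκ₀ : 0 < κ) (hκ₁ : κ ≤ 1) (hfκ : HasFiniteMoment f (1 + κ)) :
    ∫ x, seqLimit ν μ x ∂delayedBranchingLaw g f = 1 := by
  obtain ⟨-, hW, K, hK, h⟩ := exists_seqLimit_bound hg hf hν hμ hκ₀ hκ₁ hfκ
  have hρ₁ : μ ^ (-(κ / 4)) < 1 := Real.rpow_lt_one_of_one_lt_of_neg hμ (by linarith)
  have hρ₀ : 0 ≤ μ ^ (-(κ / 4)) := Real.rpow_nonneg (by linarith) _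
  have h1 : ∀ a, |1 - ∫ x, seqLimit ν μ x ∂delayedBranchingLaw g f| ≤
      K * (μ ^ (-(κ / 4))) ^ a := by
    intro a
    obtain ⟨hX, hX1⟩ := integrable_seqNormalized hg hf hν hμ a
    rw [← hX1, ← integral_sub hX hW]
    exact (abs_integral_le_integral_abs).trans (h a)
  have h2 : Tendsto (fun a : ℕ => K * (μ ^ (-(κ / 4))) ^ a) atTop (𝓝 0) := by
    simpa using (tendsto_pow_atTop_nhds_zero_of_lt_one hρ₀ hρ₁).const_mul K
  have h3 := ge_of_tendsto' h2 h1
  have := abs_nonpos_iff.1 h3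
  linarith

end Law

/-! ### The Laplace transform of the limit and the probability that it vanishes. -/

/-- The Laplace transform of the limit of the normalized generation sizes. -/
noncomputable def limitLaplace (g f : PMF ℕ) (ν μ s : ℝ) : ℝ :=
  ∫ x, Real.exp (-(s * seqLimit ν μ x)) ∂delayedBranchingLaw g f

/-- The root law `PMF.pure 1` gives the reference process: an ordinary branching process with
offspring law `f`, delayed by one generation. -/
theorem pgf_pure_one (u : ℝ) : pgf (PMF.pure 1) u = u := by
  simp [pgf, PMF.toMeasure_pure]

theorem hasMean_pure_one : HasMean (PMF.pure 1) 1 := by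
  have h := hasSum_ite_eq (1 : ℕ) (1 : ℝ)
  refine h.congr_fun fun i => ?_
  by_cases hi : i = 1 <;> simp [PMF.pure_apply, hi]

theorem measurable_exp_seqLimit (s ν μ : ℝ) :
    Measurable fun x => Real.exp (-(s * seqLimit ν μ x)) :=
  Real.measurable_exp.comp ((measurable_seqLimit ν μ).const_mul s).neg

theorem measurableSet_seqLimit_eq_zero (ν μ : ℝ) : MeasurableSet {x | seqLimit ν μ x = 0} :=
  measurableSet_eq_fun (measurable_seqLimit ν μ) measurable_const

section Laplace

variable {g f : PMF ℕ} {μ ν κ : ℝ}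

theorem exp_neg_mul_le_one {s w : ℝ} (hs : 0 ≤ s) (hw : 0 ≤ w) : Real.exp (-(s * w)) ≤ 1 :=
  Real.exp_le_one_iff.2 (by nlinarith)

theorem integrable_exp_seqLimit (hg : HasMean g ν) (hf : HasMean f μ)
    (hν : 0 < ν) (hμ : 1 < μ) (hκ₀ : 0 < κ) (hκ₁ : κ ≤ 1) (hfκ : HasFiniteMoment f (1 + κ))
    {s : ℝ} (hs : 0 ≤ s) :
    Integrable (fun x => Real.exp (-(s * seqLimit ν μ x))) (delayedBranchingLaw g f) := by
  refine Integrable.of_bound (measurable_exp_seqLimit s ν μ).aestronglyMeasurable 1 ?_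
  filter_upwards [ae_seqLimit_nonneg hg hf hν hμ hκ₀ hκ₁ hfκ] with x hx
  rw [Real.norm_of_nonneg (Real.exp_pos _).le]
  exact exp_neg_mul_le_one hs hx

/-- The generating function of generation `m + 1` at `exp(-s/(ν μ^m))` is the Laplace transform at
`s` of the normalized size; dominated convergence does the rest. -/
theorem tendsto_pgf_iterate_limitLaplace (hg : HasMean g ν) (hf : HasMean f μ)
    (hν : 0 < ν) (hμ : 1 < μ) (hκ₀ : 0 < κ) (hκ₁ : κ ≤ 1) (hfκ : HasFiniteMoment f (1 + κ))
    {s : ℝ} (hs : 0 ≤ s) :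
    Tendsto (fun m : ℕ => pgf g ((pgf f)^[m] (Real.exp (-(s / (ν * μ ^ m)))))) atTop
      (𝓝 (limitLaplace g f ν μ s)) := by
  have h1 : ∀ m : ℕ, pgf g ((pgf f)^[m] (Real.exp (-(s / (ν * μ ^ m))))) =
      ∫ x, Real.exp (-(s * seqNormalized ν μ m x)) ∂delayedBranchingLaw g f := by
    intro m
    rw [← integral_pow_delayedBranchingLaw g f
      ⟨(Real.exp_pos _).le, Real.exp_le_one_iff.2 (neg_nonpos.2 (by positivity))⟩]
    refine integral_congr_ae (ae_of_all _ fun x => ?_)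
    simp only [seqNormalized]
    rw [← Real.exp_nat_mul]
    congr 1
    ring
  simp_rw [h1]
  refine tendsto_integral_of_dominated_convergence (fun _ => 1) (fun m => ?_)
    (integrable_const 1) (fun m => ae_of_all _ fun x => ?_) ?_
  · exact (Real.measurable_exp.comp
      ((measurable_seqNormalized ν μ m).const_mul s).neg).aestronglyMeasurable
  · rw [Real.norm_of_nonneg (Real.exp_pos _).le]
    exact exp_neg_mul_le_one hs (seqNormalized_nonneg hν hμ m x)
  · filter_upwards [(exists_seqLimit_bound hg hf hν hμ hκ₀ hκ₁ hfκ).1] with x hx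
    exact (Real.continuous_exp.tendsto _).comp (hx.const_mul s).neg

theorem limitLaplace_mem_Icc (hg : HasMean g ν) (hf : HasMean f μ)
    (hν : 0 < ν) (hμ : 1 < μ) (hκ₀ : 0 < κ) (hκ₁ : κ ≤ 1) (hfκ : HasFiniteMoment f (1 + κ))
    {s : ℝ} (hs : 0 ≤ s) : limitLaplace g f ν μ s ∈ Set.Icc (0 : ℝ) 1 := by
  refine isClosed_Icc.mem_of_tendsto
    (tendsto_pgf_iterate_limitLaplace hg hf hν hμ hκ₀ hκ₁ hfκ hs) (Eventually.of_forall fun m => ?_)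
  exact pgf_mem_Icc g (pgf_iterate_mem_Icc f m
    ⟨(Real.exp_pos _).le, Real.exp_le_one_iff.2 (neg_nonpos.2 (by positivity))⟩)

/-- For `w ≥ 0`, `exp(-s w)` tends to the indicator of `w = 0` as `s → ∞`. -/
theorem tendsto_limitLaplace_atTop (hg : HasMean g ν) (hf : HasMean f μ)
    (hν : 0 < ν) (hμ : 1 < μ) (hκ₀ : 0 < κ) (hκ₁ : κ ≤ 1) (hfκ : HasFiniteMoment f (1 + κ)) :
    Tendsto (limitLaplace g f ν μ) atTop
      (𝓝 ((delayedBranchingLaw g f).real {x | seqLimit ν μ x = 0})) := by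
  rw [← integral_indicator_one (measurableSet_seqLimit_eq_zero ν μ)]
  refine tendsto_integral_filter_of_dominated_convergence (fun _ => 1)
    (Eventually.of_forall fun s => (measurable_exp_seqLimit s ν μ).aestronglyMeasurable) ?_
    (integrable_const 1) ?_
  · filter_upwards [eventually_ge_atTop 0] with s hs
    filter_upwards [ae_seqLimit_nonneg hg hf hν hμ hκ₀ hκ₁ hfκ] with x hx
    rw [Real.norm_of_nonneg (Real.exp_pos _).le]
    exact exp_neg_mul_le_one hs hx
  · filter_upwards [ae_seqLimit_nonneg hg hf hν hμ hκ₀ hκ₁ hfκ] with x hx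
    rcases hx.eq_or_lt with h | h
    · simp [Set.indicator, ← h]
    · have : x ∉ {x | seqLimit ν μ x = 0} := h.ne'
      rw [Set.indicator_of_notMem this]
      exact Real.tendsto_exp_neg_atTop_nhds_zero.comp (tendsto_id.atTop_mul_const h)

theorem integral_comp_seqLimit_pos (hg : HasMean g ν) (hf : HasMean f μ)
    (hν : 0 < ν) (hμ : 1 < μ) (hκ₀ : 0 < κ) (hκ₁ : κ ≤ 1) (hfκ : HasFiniteMoment f (1 + κ))
    {h : ℝ → ℝ} (hint : Integrable (fun x => h (seqLimit ν μ x)) (delayedBranchingLaw g f))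
    (h0 : 0 ≤ h 0) (hpos : ∀ w, 0 < w → 0 < h w) :
    0 < ∫ x, h (seqLimit ν μ x) ∂delayedBranchingLaw g f := by
  have hW := ae_seqLimit_nonneg hg hf hν hμ hκ₀ hκ₁ hfκ
  have hnn : 0 ≤ᵐ[delayedBranchingLaw g f] fun x => h (seqLimit ν μ x) := by
    filter_upwards [hW] with x hx
    rcases hx.eq_or_lt with hw | hw
    · simpa [← hw] using h0
    · exact (hpos _ hw).le
  refine (integral_nonneg_of_ae hnn).lt_of_ne fun heq => ?_
  have hz := (integral_eq_zero_iff_of_nonneg_ae hnn hint).1 heq.symm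
  have : ∫ x, seqLimit ν μ x ∂delayedBranchingLaw g f = 0 := by
    refine integral_eq_zero_of_ae ?_
    filter_upwards [hW, hz] with x hx hx'
    rcases hx.eq_or_lt with hw | hw
    · exact hw.symm
    · exact absurd hx' (hpos _ hw).ne'
  rw [integral_seqLimit hg hf hν hμ hκ₀ hκ₁ hfκ] at this
  exact one_ne_zero this

/-- Since `μ s / μ^(m+1) = s / μ^m`, shifting `m` by one in the limit of iterates leaves one extra
outer `pgf f`, which is continuous. -/
theorem limitLaplace_pure_mul (hf : HasMean f μ) (hμ : 1 < μ) (hκ₀ : 0 < κ) (hκ₁ : κ ≤ 1)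
    (hfκ : HasFiniteMoment f (1 + κ)) {s : ℝ} (hs : 0 ≤ s) :
    limitLaplace (PMF.pure 1) f 1 μ (μ * s) = pgf f (limitLaplace (PMF.pure 1) f 1 μ s) := by
  have hμ0 : 0 < μ := by linarith
  have h1 := tendsto_pgf_iterate_limitLaplace hasMean_pure_one hf one_pos hμ hκ₀ hκ₁ hfκ
    (s := μ * s) (by positivity)
  have h2 := tendsto_pgf_iterate_limitLaplace hasMean_pure_one hf one_pos hμ hκ₀ hκ₁ hfκ hs
  have h3 := h1.comp (tendsto_add_atTop_nat 1)
  simp only [pgf_pure_one, Function.comp_def, one_mul] at h2 h3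
  refine tendsto_nhds_unique h3 ?_
  have hc := continuousOn_pgf hf _
    (limitLaplace_mem_Icc hasMean_pure_one hf one_pos hμ hκ₀ hκ₁ hfκ hs)
  have h4 := hc.tendsto.comp (tendsto_nhdsWithin_iff.2 ⟨h2, Eventually.of_forall fun m =>
    pgf_iterate_mem_Icc f m ⟨(Real.exp_pos _).le,
      Real.exp_le_one_iff.2 (neg_nonpos.2 (by positivity))⟩⟩)
  refine h4.congr fun m => ?_
  have : μ * s / μ ^ (m + 1) = s / μ ^ m := by
    rw [pow_succ', mul_div_mul_left _ _ hμ0.ne']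
  rw [this, Function.iterate_succ_apply']
  rfl

theorem limitLaplace_eq_pgf (hg : HasMean g ν) (hf : HasMean f μ)
    (hν : 0 < ν) (hμ : 1 < μ) (hκ₀ : 0 < κ) (hκ₁ : κ ≤ 1) (hfκ : HasFiniteMoment f (1 + κ))
    {s : ℝ} (hs : 0 ≤ s) :
    limitLaplace g f ν μ s = pgf g (limitLaplace (PMF.pure 1) f 1 μ (s / ν)) := by
  have h1 := tendsto_pgf_iterate_limitLaplace hg hf hν hμ hκ₀ hκ₁ hfκ hs
  have hs' : 0 ≤ s / ν := by positivity
  have h2 := tendsto_pgf_iterate_limitLaplace hasMean_pure_one hf one_pos hμ hκ₀ hκ₁ hfκ hs'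
  simp only [pgf_pure_one, one_mul, div_div] at h2
  refine tendsto_nhds_unique h1 ?_
  have hc := continuousOn_pgf hg _
    (limitLaplace_mem_Icc hasMean_pure_one hf one_pos hμ hκ₀ hκ₁ hfκ hs')
  exact hc.tendsto.comp (tendsto_nhdsWithin_iff.2 ⟨h2, Eventually.of_forall fun m =>
    pgf_iterate_mem_Icc f m ⟨(Real.exp_pos _).le,
      Real.exp_le_one_iff.2 (neg_nonpos.2 (by positivity))⟩⟩)

theorem measureReal_seqLimit_eq_zero (hg : HasMean g ν) (hf : HasMean f μ)
    (hν : 0 < ν) (hμ : 1 < μ) (hκ₀ : 0 < κ) (hκ₁ : κ ≤ 1) (hfκ : HasFiniteMoment f (1 + κ)) :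
    (delayedBranchingLaw g f).real {x | seqLimit ν μ x = 0} =
      pgf g ((delayedBranchingLaw (PMF.pure 1) f).real {x | seqLimit 1 μ x = 0}) := by
  have h1 := tendsto_limitLaplace_atTop hg hf hν hμ hκ₀ hκ₁ hfκ
  have h2 := (tendsto_limitLaplace_atTop hasMean_pure_one hf one_pos hμ hκ₀ hκ₁ hfκ).comp
    (tendsto_id.atTop_div_const hν)
  refine tendsto_nhds_unique h1 ?_
  have hc := continuousOn_pgf hg _
    (⟨measureReal_nonneg, measureReal_le_one⟩ :
      (delayedBranchingLaw (PMF.pure 1) f).real {x | seqLimit 1 μ x = 0} ∈ Set.Icc (0 : ℝ) 1)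
  have h3 := hc.tendsto.comp (tendsto_nhdsWithin_iff.2 ⟨h2, by
    filter_upwards [eventually_ge_atTop 0] with s hs
    exact limitLaplace_mem_Icc hasMean_pure_one hf one_pos hμ hκ₀ hκ₁ hfκ
      (div_nonneg hs hν.le)⟩)
  refine h3.congr' ?_
  filter_upwards [eventually_ge_atTop 0] with s hs
  exact (limitLaplace_eq_pgf hg hf hν hμ hκ₀ hκ₁ hfκ hs).symm

/-- Let `s → ∞` in `limitLaplace_pure_mul`. -/
theorem pgf_extinction (hf : HasMean f μ) (hμ : 1 < μ) (hκ₀ : 0 < κ) (hκ₁ : κ ≤ 1)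
    (hfκ : HasFiniteMoment f (1 + κ)) :
    pgf f ((delayedBranchingLaw (PMF.pure 1) f).real {x | seqLimit 1 μ x = 0}) =
      (delayedBranchingLaw (PMF.pure 1) f).real {x | seqLimit 1 μ x = 0} := by
  have hμ0 : 0 < μ := by linarith
  have h1 := tendsto_limitLaplace_atTop hasMean_pure_one hf one_pos hμ hκ₀ hκ₁ hfκ
  have h2 := h1.comp (tendsto_id.const_mul_atTop hμ0)
  have hc := continuousOn_pgf hf _
    (⟨measureReal_nonneg, measureReal_le_one⟩ :
      (delayedBranchingLaw (PMF.pure 1) f).real {x | seqLimit 1 μ x = 0} ∈ Set.Icc (0 : ℝ) 1)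
  have h3 := hc.tendsto.comp (tendsto_nhdsWithin_iff.2 ⟨h1, by
    filter_upwards [eventually_ge_atTop 0] with s hs
    exact limitLaplace_mem_Icc hasMean_pure_one hf one_pos hμ hκ₀ hκ₁ hfκ hs⟩)
  refine tendsto_nhds_unique (h3.congr' ?_) h2
  filter_upwards [eventually_ge_atTop 0] with s hs
  exact (limitLaplace_pure_mul hf hμ hκ₀ hκ₁ hfκ hs).symm

/-- For the reference process and its transform `φ`, the functional equation turns this into `pgf f
(φ 1) < φ 1`, the starting condition for contraction. -/
theorem limitLaplace_lt (hg : HasMean g ν) (hf : HasMean f μ)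
    (hν : 0 < ν) (hμ : 1 < μ) (hκ₀ : 0 < κ) (hκ₁ : κ ≤ 1) (hfκ : HasFiniteMoment f (1 + κ)) :
    limitLaplace g f ν μ μ < limitLaplace g f ν μ 1 := by
  have hi1 := integrable_exp_seqLimit hg hf hν hμ hκ₀ hκ₁ hfκ zero_le_one
  have hiμ := integrable_exp_seqLimit hg hf hν hμ hκ₀ hκ₁ hfκ (zero_le_one.trans hμ.le)
  have := integral_comp_seqLimit_pos hg hf hν hμ hκ₀ hκ₁ hfκ
    (h := fun w => Real.exp (-(1 * w)) - Real.exp (-(μ * w))) (hi1.sub hiμ) (by simp)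
    fun w hw => sub_pos.2 (Real.exp_lt_exp.2 (by nlinarith))
  rw [integral_sub hi1 hiμ] at this
  exact sub_pos.1 this

theorem measureReal_lt_limitLaplace (hg : HasMean g ν) (hf : HasMean f μ)
    (hν : 0 < ν) (hμ : 1 < μ) (hκ₀ : 0 < κ) (hκ₁ : κ ≤ 1) (hfκ : HasFiniteMoment f (1 + κ)) :
    (delayedBranchingLaw g f).real {x | seqLimit ν μ x = 0} < limitLaplace g f ν μ 1 := by
  have hi1 := integrable_exp_seqLimit hg hf hν hμ hκ₀ hκ₁ hfκ zero_le_one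
  have hi0 : Integrable ({x | seqLimit ν μ x = 0}.indicator (1 : (ℕ → ℕ) → ℝ))
      (delayedBranchingLaw g f) :=
    (integrable_const (1 : ℝ)).indicator (measurableSet_seqLimit_eq_zero ν μ)
  have := integral_comp_seqLimit_pos hg hf hν hμ hκ₀ hκ₁ hfκ
    (h := fun w => Real.exp (-(1 * w)) - ({0} : Set ℝ).indicator 1 w) (hi1.sub hi0) (by simp)
    fun w hw => by simpa [hw.ne'] using Real.exp_pos _
  have h2 := integral_sub hi1 hi0
  rw [integral_indicator_one (measurableSet_seqLimit_eq_zero ν μ)] at h2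
  exact sub_pos.1 (this.trans_eq h2)

theorem limitLaplace_anti (hg : HasMean g ν) (hf : HasMean f μ)
    (hν : 0 < ν) (hμ : 1 < μ) (hκ₀ : 0 < κ) (hκ₁ : κ ≤ 1) (hfκ : HasFiniteMoment f (1 + κ))
    {s t : ℝ} (hs : 0 ≤ s) (hst : s ≤ t) : limitLaplace g f ν μ t ≤ limitLaplace g f ν μ s := by
  refine integral_mono_ae (integrable_exp_seqLimit hg hf hν hμ hκ₀ hκ₁ hfκ (hs.trans hst))
    (integrable_exp_seqLimit hg hf hν hμ hκ₀ hκ₁ hfκ hs) ?_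
  filter_upwards [ae_seqLimit_nonneg hg hf hν hμ hκ₀ hκ₁ hfκ] with x hx
  exact Real.exp_le_exp.2 (neg_le_neg (mul_le_mul_of_nonneg_right hst hx))

/-! ### Geometric rates on survival and for late extinction. -/

/-- Geometric convergence of the iterates of a generating function to a fixed point `q` below a
point `v` with `pgf f v < v`. -/
theorem exists_pgf_iterate_rate {q v : ℝ} (hq : 0 ≤ q) (hqf : pgf f q = q) (hqv : q < v)
    (hv : v ≤ 1) (hfv : pgf f v < v) :
    ∃ c : ℝ, 0 < c ∧ c < 1 ∧ ∀ (k : ℕ), ∀ u ∈ Set.Icc 0 v, |(pgf f)^[k] u - q| ≤ c ^ k := by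
  have hvq : 0 < v - q := sub_pos.2 hqv
  have hmem : Set.MapsTo (pgf f) (Set.Icc 0 v) (Set.Icc 0 v) := fun u hu =>
    ⟨pgf_nonneg f hu.1, (pgf_mono f hu.1 hu.2 hv).trans hfv.le⟩
  set c₀ := (pgf f v - pgf f q) / (v - q) with hc₀
  have hc₀1 : c₀ < 1 := by rw [hc₀, div_lt_one hvq, hqf]; linarith
  -- The maximum with `1/2` only keeps the rate positive, so that its logarithm can be used later.
  refine ⟨max c₀ (1 / 2), by positivity, max_lt hc₀1 (by norm_num), fun k u hu => ?_⟩
  set c := max c₀ (1 / 2)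
  have hstep : ∀ w ∈ Set.Icc 0 v, |pgf f w - q| ≤ c * |w - q| := by
    intro w hw
    by_cases hwq : w = q
    · simp [hwq, hqf]
    -- By convexity the chord from `q` to `w` is no steeper than the chord from `q` to `v`, whose
    -- slope is below 1.
    have hsec := (convexOn_pgf f).secant_mono ⟨hq, hqv.le.trans hv⟩ ⟨hw.1, hw.2.trans hv⟩
      ⟨hq.trans hqv.le, hv⟩ hwq hqv.ne' hw.2
    have hsec0 : 0 ≤ (pgf f w - pgf f q) / (w - q) := by
      rcases le_total w q with h | h
      · exact div_nonneg_of_nonpos (sub_nonpos.2 (pgf_mono f hw.1 h (hqv.le.trans hv)))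
          (sub_nonpos.2 h)
      · exact div_nonneg (sub_nonneg.2 (pgf_mono f hq h (hw.2.trans hv))) (sub_nonneg.2 h)
    have he : pgf f w - q = (pgf f w - pgf f q) / (w - q) * (w - q) := by
      rw [div_mul_cancel₀ _ (sub_ne_zero.2 hwq), hqf]
    rw [he, abs_mul, abs_of_nonneg hsec0]
    exact mul_le_mul_of_nonneg_right (hsec.trans (le_max_left _ _)) (abs_nonneg _)
  induction k with
  | zero =>
    simp only [Function.iterate_zero, id, pow_zero]
    rw [abs_le]
    constructor <;> linarith [hu.1, hu.2]
  | succ k ih =>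
    rw [Function.iterate_succ_apply', pow_succ']
    exact (hstep _ (hmem.iterate k hu)).trans
      (mul_le_mul_of_nonneg_left ih (le_max_of_le_right (by norm_num)))

theorem ae_seqLimit_eq_zero_of_extinct (hg : HasMean g ν) (hf : HasMean f μ)
    (hν : 0 < ν) (hμ : 1 < μ) (hκ₀ : 0 < κ) (hκ₁ : κ ≤ 1) (hfκ : HasFiniteMoment f (1 + κ)) :
    ∀ᵐ x ∂delayedBranchingLaw g f, ∀ m, x m = 0 → seqLimit ν μ x = 0 := by
  filter_upwards [ae_delayedBranchingLaw_absorbing g f,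
    (exists_seqLimit_bound hg hf hν hμ hκ₀ hκ₁ hfκ).1] with x hx hW m hm
  refine tendsto_nhds_unique hW (tendsto_const_nhds.congr' ?_)
  filter_upwards [eventually_ge_atTop m] with a ha
  simp [seqNormalized, hx m (a + 1) (ha.trans a.le_succ) hm]

/-- Both the lower tail of the limit on survival and the probability of late extinction decay
geometrically. -/
theorem exists_survival_rate (hf : HasMean f μ) (hμ : 1 < μ) (hκ₀ : 0 < κ) (hκ₁ : κ ≤ 1)
    (hfκ : HasFiniteMoment f (1 + κ)) :
    ∃ c : ℝ, 0 < c ∧ c < 1 ∧ ∀ (g : PMF ℕ) (ν : ℝ), HasMean g ν → 0 < ν →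
      (∀ (k : ℕ) (s : ℝ), ν * μ ^ k ≤ s →
        ∫ x, {x | seqLimit ν μ x ≠ 0}.indicator (fun x => Real.exp (-(s * seqLimit ν μ x))) x
          ∂delayedBranchingLaw g f ≤ ν * c ^ k) ∧
      ∀ m : ℕ, (delayedBranchingLaw g f).real {x | seqLimit ν μ x = 0 ∧ x (m + 1) ≠ 0} ≤
        ν * c ^ m := by
  set φ := limitLaplace (PMF.pure 1) f 1 μ with hφ
  set q := (delayedBranchingLaw (PMF.pure 1) f).real {x | seqLimit 1 μ x = 0} with hq
  have hμ0 : 0 < μ := by linarith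
  have hφmem : ∀ s, 0 ≤ s → φ s ∈ Set.Icc (0 : ℝ) 1 := fun s hs =>
    limitLaplace_mem_Icc hasMean_pure_one hf one_pos hμ hκ₀ hκ₁ hfκ hs
  have hφμ : φ μ = pgf f (φ 1) := by
    simpa using limitLaplace_pure_mul hf hμ hκ₀ hκ₁ hfκ zero_le_one
  have hq0 : 0 ≤ q := measureReal_nonneg
  have hqf : pgf f q = q := pgf_extinction hf hμ hκ₀ hκ₁ hfκ
  have hq1 : q < φ 1 := measureReal_lt_limitLaplace hasMean_pure_one hf one_pos hμ hκ₀ hκ₁ hfκ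
  have hφpow : ∀ k : ℕ, φ (μ ^ k) = (pgf f)^[k] (φ 1) := by
    intro k
    induction k with
    | zero => simp
    | succ k ih =>
      rw [pow_succ', Function.iterate_succ_apply', ← ih]
      exact limitLaplace_pure_mul hf hμ hκ₀ hκ₁ hfκ (by positivity)
  obtain ⟨c, hc0, hc1, hc⟩ := exists_pgf_iterate_rate hq0 hqf hq1 (hφmem 1 zero_le_one).2
    (hφμ ▸ limitLaplace_lt hasMean_pure_one hf one_pos hμ hκ₀ hκ₁ hfκ)
  have hq_mem : q ∈ Set.Icc (0 : ℝ) 1 := ⟨hq0, measureReal_le_one⟩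
  -- The rate depends on `f` alone; the root law enters only through the Lipschitz constant `ν` of
  -- its generating function.
  refine ⟨c, hc0, hc1, fun g ν hg hν => ?_⟩
  have hext := measureReal_seqLimit_eq_zero hg hf hν hμ hκ₀ hκ₁ hfκ
  have hzm := measurableSet_seqLimit_eq_zero ν μ
  have hi0 : Integrable ({x | seqLimit ν μ x = 0}.indicator (1 : (ℕ → ℕ) → ℝ))
      (delayedBranchingLaw g f) := (integrable_const (1 : ℝ)).indicator hzm
  constructor
  · intro k s hs
    have hs0 : 0 ≤ s := le_trans (by positivity) hs
    have hi := integrable_exp_seqLimit hg hf hν hμ hκ₀ hκ₁ hfκ hs0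
    -- Where the limit vanishes the exponential is 1, so removing that event subtracts exactly its
    -- probability.
    have h1 : ∫ x, {x | seqLimit ν μ x ≠ 0}.indicator (fun x => Real.exp (-(s * seqLimit ν μ x))) x
        ∂delayedBranchingLaw g f = limitLaplace g f ν μ s - pgf g q := by
      rw [← hext, ← integral_indicator_one hzm, limitLaplace, ← integral_sub hi hi0]
      refine integral_congr_ae (ae_of_all _ fun x => ?_)
      by_cases hx : seqLimit ν μ x = 0 <;> simp [Set.indicator, hx]
    rw [h1, limitLaplace_eq_pgf hg hf hν hμ hκ₀ hκ₁ hfκ hs0]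
    have hsν : μ ^ k ≤ s / ν := by rw [le_div_iff₀ hν]; linarith
    have h2 : φ (s / ν) ≤ φ (μ ^ k) :=
      limitLaplace_anti hasMean_pure_one hf one_pos hμ hκ₀ hκ₁ hfκ (by positivity) hsν
    have h3 := hc k (φ 1) ⟨(hφmem 1 zero_le_one).1, le_rfl⟩
    rw [← hφpow] at h3
    have hpm := hφmem (μ ^ k) (by positivity)
    calc pgf g (φ (s / ν)) - pgf g q ≤ pgf g (φ (μ ^ k)) - pgf g q := by
          gcongr
          exact pgf_mono g (hφmem _ (by positivity)).1 h2 hpm.2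
      _ ≤ |pgf g (φ (μ ^ k)) - pgf g q| := le_abs_self _
      _ ≤ ν * |φ (μ ^ k) - q| := abs_pgf_sub_le hg hpm hq_mem
      _ ≤ ν * c ^ k := by gcongr
  · intro m
    have hmz : MeasurableSet {x : ℕ → ℕ | x (m + 1) ≠ 0} :=
      (measurableSet_eq_fun (measurable_pi_apply (m + 1)) measurable_const).compl
    have hmeas : MeasurableSet {x | seqLimit ν μ x = 0 ∧ x (m + 1) ≠ 0} := hzm.inter hmz
    have hip : Integrable (fun x : ℕ → ℕ => (0 : ℝ) ^ x (m + 1)) (delayedBranchingLaw g f) := by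
      refine Integrable.of_bound ((measurable_of_countable fun i : ℕ => (0 : ℝ) ^ i).comp
        (measurable_pi_apply (m + 1))).aestronglyMeasurable 1 (ae_of_all _ fun x => ?_)
      by_cases hx : x (m + 1) = 0 <;> simp [hx]
    -- As `0 ^ x (m + 1)` is the indicator of extinction, and extinction forces a zero limit almost
    -- surely, the probability is a difference of two nested ones.
    have h1 : (delayedBranchingLaw g f).real {x | seqLimit ν μ x = 0 ∧ x (m + 1) ≠ 0} =
        pgf g q - pgf g ((pgf f)^[m] 0) := by
      rw [← hext, ← integral_indicator_one hmeas, ← integral_indicator_one hzm,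
        ← integral_pow_delayedBranchingLaw g f ⟨le_rfl, zero_le_one⟩, ← integral_sub hi0 hip]
      refine integral_congr_ae ?_
      filter_upwards [ae_seqLimit_eq_zero_of_extinct hg hf hν hμ hκ₀ hκ₁ hfκ] with x hx
      by_cases h : x (m + 1) = 0
      · simp [Set.indicator, h, hx _ h]
      · by_cases h' : seqLimit ν μ x = 0 <;> simp [Set.indicator, h, h']
    rw [h1]
    have h0 := pgf_iterate_mem_Icc f m (u := 0) ⟨le_rfl, zero_le_one⟩
    calc pgf g q - pgf g ((pgf f)^[m] 0) ≤ |pgf g ((pgf f)^[m] 0) - pgf g q| := by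
          rw [abs_sub_comm]; exact le_abs_self _
      _ ≤ ν * |(pgf f)^[m] 0 - q| := abs_pgf_sub_le hg h0 hq_mem
      _ ≤ ν * c ^ m := by
          gcongr
          exact hc m 0 ⟨le_rfl, hq0.trans hq1.le⟩

end Laplace

/-! ### The sum over pairs of generations and its `L¹` approximation. -/

theorem integral_abs_mul_sub_mul_le {α β : Type*} [MeasurableSpace α] [MeasurableSpace β]
    {P : Measure α} {Q : Measure β} [SFinite P] [SFinite Q] {X W : α → ℝ} {Y V : β → ℝ}
    (hX : Integrable X P) (hW : Integrable W P) (hY : Integrable Y Q) (hV : Integrable V Q) :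
    ∫ p, |X p.1 * Y p.2 - W p.1 * V p.2| ∂P.prod Q ≤
      (∫ x, |X x - W x| ∂P) * (∫ y, |Y y| ∂Q) + (∫ x, |W x| ∂P) * ∫ y, |Y y - V y| ∂Q := by
  rw [← integral_prod_mul, ← integral_prod_mul]
  have h1 : Integrable (fun p : α × β => |X p.1 - W p.1| * |Y p.2|) (P.prod Q) :=
    (hX.sub hW).abs.mul_prod hY.abs
  have h2 : Integrable (fun p : α × β => |W p.1| * |Y p.2 - V p.2|) (P.prod Q) :=
    hW.abs.mul_prod (hY.sub hV).abs
  rw [← integral_add h1 h2]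
  refine integral_mono ((hX.mul_prod hY).sub (hW.mul_prod hV)).abs (h1.add h2) fun p => ?_
  simp only
  rw [← abs_mul, ← abs_mul]
  refine le_trans (le_of_eq ?_) (abs_add_le _ _)
  congr 1
  ring

/-- The sum `∑ x ⌈i / 2⌉ * y ⌊i / 2⌋` over `2 ≤ i ≤ k + 1` for a pair of sequences. -/
noncomputable def pairSum (k : ℕ) (p : (ℕ → ℕ) × (ℕ → ℕ)) : ℝ :=
  ∑ i ∈ Finset.Icc 2 (k + 1), (p.1 ((i + 1) / 2) : ℝ) * (p.2 (i / 2) : ℝ)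

theorem measurable_pairSum (k : ℕ) : Measurable (pairSum k) := by
  unfold pairSum
  refine Finset.measurable_sum _ fun i _ => ?_
  have hc := measurable_of_countable fun x : ℕ => (x : ℝ)
  exact (hc.comp ((measurable_pi_apply _).comp measurable_fst)).mul
    (hc.comp ((measurable_pi_apply _).comp measurable_snd))

theorem pairSum_nonneg (k : ℕ) (p : (ℕ → ℕ) × (ℕ → ℕ)) : 0 ≤ pairSum k p :=
  Finset.sum_nonneg fun i _ => by positivity

theorem pairSum_mono {k l : ℕ} (h : k ≤ l) (p : (ℕ → ℕ) × (ℕ → ℕ)) :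
    pairSum k p ≤ pairSum l p :=
  Finset.sum_le_sum_of_subset_of_nonneg (Finset.Icc_subset_Icc le_rfl (by omega))
    fun i _ _ => by positivity

/-- The additional terms have `i ≥ k + 2`, so both of their generation indices are at least `k / 2 +
1`. -/
theorem pairSum_eq_of_extinct {k l : ℕ} (h : k ≤ l) {p : (ℕ → ℕ) × (ℕ → ℕ)}
    (hp : (∀ j, k / 2 + 1 ≤ j → p.1 j = 0) ∨ ∀ j, k / 2 + 1 ≤ j → p.2 j = 0) :
    pairSum l p = pairSum k p := by
  refine (Finset.sum_subset (Finset.Icc_subset_Icc le_rfl (by omega)) fun i hi hi' => ?_).symm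
  simp only [Finset.mem_Icc, not_and, not_le] at hi hi'
  have := hi' hi.1
  rcases hp with hp | hp
  · rw [hp ((i + 1) / 2) (by omega)]; simp
  · rw [hp (i / 2) (by omega)]; simp

/-- Put `i = j + 2`: the shift by 2 matches the shift by one generation in each factor, and the
normalizing powers combine because `⌈j/2⌉ + ⌊j/2⌋ = j`. -/
theorem pairSum_eq_sum_range {ν μ : ℝ} (hν : 0 < ν) (hμ : 1 < μ) (k : ℕ)
    (p : (ℕ → ℕ) × (ℕ → ℕ)) :
    pairSum k p = ν ^ 2 * ∑ j ∈ Finset.range k,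
      μ ^ j * (seqNormalized ν μ ((j + 1) / 2) p.1 * seqNormalized ν μ (j / 2) p.2) := by
  have h1 : pairSum k p = ∑ j ∈ Finset.range k,
      (p.1 ((j + 1) / 2 + 1) : ℝ) * (p.2 (j / 2 + 1) : ℝ) := by
    unfold pairSum
    have : Finset.Icc 2 (k + 1) = Finset.Ico (0 + 2) (k + 2) := by
      ext i; simp only [Finset.mem_Icc, Finset.mem_Ico]; omega
    rw [this, ← Finset.sum_Ico_add' (fun i => (p.1 ((i + 1) / 2) : ℝ) * (p.2 (i / 2) : ℝ)) 0 k 2,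
      Finset.range_eq_Ico]
    refine Finset.sum_congr rfl fun j _ => ?_
    have e1 : (j + 2 + 1) / 2 = (j + 1) / 2 + 1 := by omega
    have e2 : (j + 2) / 2 = j / 2 + 1 := by omega
    rw [e1, e2]
  rw [h1, Finset.mul_sum]
  refine Finset.sum_congr rfl fun j _ => ?_
  have e : μ ^ j = μ ^ ((j + 1) / 2) * μ ^ (j / 2) := by
    rw [← pow_add]; congr 1; omega
  have hμ0 : μ ≠ 0 := by linarith
  rw [e]
  unfold seqNormalized
  field_simp

section Pair

variable {gp fp gm fm : PMF ℕ} {μ ν κ : ℝ}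

/-- The `L¹` distance of the two exponents. -/
theorem exists_integral_abs_pairSum_sub_le (hgp : HasMean gp ν) (hfp : HasMean fp μ)
    (hgm : HasMean gm ν) (hfm : HasMean fm μ) (hν : 0 < ν) (hμ : 1 < μ) (hκ₀ : 0 < κ) (hκ₁ : κ ≤ 1)
    (hfpκ : HasFiniteMoment fp (1 + κ)) (hfmκ : HasFiniteMoment fm (1 + κ)) :
    ∃ K : ℝ, 0 ≤ K ∧ ∀ n : ℕ, 0 < n → ∀ k : ℕ,
      Integrable (fun p : (ℕ → ℕ) × (ℕ → ℕ) => 1 / (ν * n) * pairSum k p -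
        ν * μ ^ k / ((μ - 1) * n) * (seqLimit ν μ p.1 * seqLimit ν μ p.2))
        ((delayedBranchingLaw gp fp).prod (delayedBranchingLaw gm fm)) ∧
      ∫ p, |1 / (ν * n) * pairSum k p -
        ν * μ ^ k / ((μ - 1) * n) * (seqLimit ν μ p.1 * seqLimit ν μ p.2)|
        ∂(delayedBranchingLaw gp fp).prod (delayedBranchingLaw gm fm) ≤
      K * ((μ ^ k) ^ (1 - κ / 8) / n) := by
  obtain ⟨-, hWp, Kp, hKp, hp⟩ := exists_seqLimit_bound hgp hfp hν hμ hκ₀ hκ₁ hfpκ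
  obtain ⟨-, hWm, Km, hKm, hm⟩ := exists_seqLimit_bound hgm hfm hν hμ hκ₀ hκ₁ hfmκ
  have hWp1 : ∫ x, |seqLimit ν μ x| ∂delayedBranchingLaw gp fp = 1 := by
    rw [← integral_seqLimit hgp hfp hν hμ hκ₀ hκ₁ hfpκ]
    refine integral_congr_ae ?_
    filter_upwards [ae_seqLimit_nonneg hgp hfp hν hμ hκ₀ hκ₁ hfpκ] with x hx
    exact abs_of_nonneg hx
  have hWm1 : ∫ x, |seqLimit ν μ x| ∂delayedBranchingLaw gm fm = 1 := by
    rw [← integral_seqLimit hgm hfm hν hμ hκ₀ hκ₁ hfmκ]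
    refine integral_congr_ae ?_
    filter_upwards [ae_seqLimit_nonneg hgm hfm hν hμ hκ₀ hκ₁ hfmκ] with x hx
    exact abs_of_nonneg hx
  have hXm1 : ∀ a, ∫ x, |seqNormalized ν μ a x| ∂delayedBranchingLaw gm fm = 1 := by
    intro a
    simp_rw [fun x => abs_of_nonneg (seqNormalized_nonneg hν hμ a x)]
    exact (integrable_seqNormalized hgm hfm hν hμ a).2
  set Pr := (delayedBranchingLaw gp fp).prod (delayedBranchingLaw gm fm) with hPr
  have hμ0 : 0 < μ := by linarith
  set ρ := μ ^ (-(κ / 4)) with hρ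
  set σ := μ ^ (-(κ / 8)) with hσ
  have hσ0 : 0 < σ := by positivity
  have hσ1 : σ ≤ 1 := (Real.rpow_lt_one_of_one_lt_of_neg hμ (by linarith)).le
  have hρσ : ρ = σ ^ 2 := by
    rw [hρ, hσ, ← Real.rpow_mul_natCast hμ0.le]; congr 1; push_cast; ring
  -- Generations near `j/2` give only the square root `σ` of the rate per step of `j`; rounding down
  -- costs one further factor `σ`.
  have hρj : ∀ i j : ℕ, j ≤ 2 * i + 1 → ρ ^ i ≤ σ ^ j / σ := by
    intro i j hij
    rw [hρσ, ← pow_mul, le_div_iff₀ hσ0, ← pow_succ]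
    exact pow_le_pow_of_le_one hσ0.le hσ1 hij
  set θ := μ * σ with hθ
  have hθμ : θ = μ ^ (1 - κ / 8) := by
    rw [hθ, hσ, sub_eq_add_neg, Real.rpow_add hμ0, Real.rpow_one]
  have hθ1 : 1 < θ := by rw [hθμ]; exact Real.one_lt_rpow hμ (by linarith)
  have hθk : ∀ k : ℕ, (μ ^ k) ^ (1 - κ / 8) = θ ^ k := by
    intro k
    rw [hθμ, ← Real.rpow_mul_natCast hμ0.le, ← Real.rpow_natCast_mul hμ0.le, mul_comm]
  let T : ℕ → (ℕ → ℕ) × (ℕ → ℕ) → ℝ := fun j p =>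
    seqNormalized ν μ ((j + 1) / 2) p.1 * seqNormalized ν μ (j / 2) p.2 -
      seqLimit ν μ p.1 * seqLimit ν μ p.2
  have hWW : Integrable (fun p : (ℕ → ℕ) × (ℕ → ℕ) => seqLimit ν μ p.1 * seqLimit ν μ p.2) Pr :=
    hWp.mul_prod hWm
  have hTi : ∀ j, Integrable (T j) Pr := fun j =>
    ((integrable_seqNormalized hgp hfp hν hμ _).1.mul_prod
      (integrable_seqNormalized hgm hfm hν hμ _).1).sub hWW
  have hT : ∀ j, ∫ p, |T j p| ∂Pr ≤ (Kp + Km) * (σ ^ j / σ) := by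
    intro j
    have := integral_abs_mul_sub_mul_le (integrable_seqNormalized hgp hfp hν hμ ((j + 1) / 2)).1
      hWp (integrable_seqNormalized hgm hfm hν hμ (j / 2)).1 hWm
    rw [hXm1, hWp1, mul_one, one_mul] at this
    refine this.trans ?_
    rw [add_mul]
    refine add_le_add ((hp _).trans ?_) ((hm _).trans ?_)
    · exact mul_le_mul_of_nonneg_left (hρj _ _ (by omega)) hKp
    · exact mul_le_mul_of_nonneg_left (hρj _ _ (by omega)) hKm
  have hWW1 : ∫ p, |seqLimit ν μ p.1 * seqLimit ν μ p.2| ∂Pr = 1 := by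
    simp_rw [abs_mul]
    rw [hPr, integral_prod_mul (fun x => |seqLimit ν μ x|) fun x => |seqLimit ν μ x|, hWp1, hWm1,
      one_mul]
  refine ⟨ν * ((Kp + Km) / σ / (θ - 1) + 1 / (μ - 1)), ?_, fun n hn k => ?_⟩
  · have : 0 < θ - 1 := by linarith
    have : 0 < μ - 1 := by linarith
    positivity
  have hn' : (0 : ℝ) < n := by exact_mod_cast hn
  have hμ1 : 0 < μ - 1 := by linarith
  -- The weights sum to `(μ^k - 1)/(μ - 1)`; the `-1` leaves the term `W⁺W⁻/(μ - 1)`, later absorbed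
  -- because `θ^k ≥ 1`.
  have hdec : ∀ p : (ℕ → ℕ) × (ℕ → ℕ), 1 / (ν * n) * pairSum k p -
      ν * μ ^ k / ((μ - 1) * n) * (seqLimit ν μ p.1 * seqLimit ν μ p.2) =
      ν / n * (∑ j ∈ Finset.range k, μ ^ j * T j p -
        1 / (μ - 1) * (seqLimit ν μ p.1 * seqLimit ν μ p.2)) := by
    intro p
    rw [pairSum_eq_sum_range hν hμ]
    simp only [T, mul_sub, Finset.sum_sub_distrib]
    rw [← Finset.sum_mul, geom_sum_eq hμ.ne']
    field_simp
    ring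
  have hSi : Integrable (fun p => ∑ j ∈ Finset.range k, μ ^ j * T j p) Pr :=
    integrable_finsetSum _ fun j _ => (hTi j).const_mul _
  have hSai : Integrable (fun p => ∑ j ∈ Finset.range k, μ ^ j * |T j p|) Pr :=
    integrable_finsetSum _ fun j _ => (hTi j).abs.const_mul _
  simp_rw [hdec]
  have hDi : Integrable (fun p : (ℕ → ℕ) × (ℕ → ℕ) => ν / n * (∑ j ∈ Finset.range k, μ ^ j * T j p -
        1 / (μ - 1) * (seqLimit ν μ p.1 * seqLimit ν μ p.2))) Pr :=
    (hSi.sub (hWW.const_mul _)).const_mul _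
  refine ⟨hDi, ?_⟩
  have hWi := hWW.abs.const_mul (1 / (μ - 1))
  calc ∫ p, |ν / n * (∑ j ∈ Finset.range k, μ ^ j * T j p -
        1 / (μ - 1) * (seqLimit ν μ p.1 * seqLimit ν μ p.2))| ∂Pr
      ≤ ∫ p, ν / n * (∑ j ∈ Finset.range k, μ ^ j * |T j p| +
        1 / (μ - 1) * |seqLimit ν μ p.1 * seqLimit ν μ p.2|) ∂Pr := by
        refine integral_mono hDi.abs ((hSai.add hWi).const_mul _) fun p => ?_
        simp only
        rw [abs_mul, abs_of_nonneg (by positivity : 0 ≤ ν / n)]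
        refine mul_le_mul_of_nonneg_left ((abs_sub _ _).trans (add_le_add ?_ ?_)) (by positivity)
        · refine (Finset.abs_sum_le_sum_abs _ _).trans_eq (Finset.sum_congr rfl fun j _ => ?_)
          rw [abs_mul, abs_of_nonneg (by positivity : 0 ≤ μ ^ j)]
        · rw [abs_mul, abs_of_nonneg (by positivity : 0 ≤ 1 / (μ - 1))]
    _ = ν / n * (∑ j ∈ Finset.range k, μ ^ j * ∫ p, |T j p| ∂Pr + 1 / (μ - 1)) := by
        rw [integral_const_mul, integral_add hSai hWi,
          integral_finsetSum _ fun j _ => (hTi j).abs.const_mul _, integral_const_mul, hWW1,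
          mul_one]
        simp_rw [integral_const_mul]
    _ ≤ ν / n * ((Kp + Km) / σ / (θ - 1) * θ ^ k + 1 / (μ - 1) * θ ^ k) := by
        have hθ1' : 0 < θ - 1 := by linarith
        refine mul_le_mul_of_nonneg_left (add_le_add ?_ ?_) (by positivity)
        · calc ∑ j ∈ Finset.range k, μ ^ j * ∫ p, |T j p| ∂Pr
              ≤ ∑ j ∈ Finset.range k, (Kp + Km) / σ * θ ^ j := by
                refine Finset.sum_le_sum fun j _ => ?_
                refine (mul_le_mul_of_nonneg_left (hT j) (by positivity)).trans_eq ?_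
                rw [hθ, mul_pow]; ring
            _ = (Kp + Km) / σ * ((θ ^ k - 1) / (θ - 1)) := by
                rw [← Finset.mul_sum, geom_sum_eq hθ1.ne']
            _ ≤ (Kp + Km) / σ * (θ ^ k / (θ - 1)) := by
                gcongr
                linarith
            _ = _ := by ring
        · exact le_mul_of_one_le_right (by positivity) (one_le_pow₀ hθ1.le)
    _ = _ := by
        rw [hθk]; ring

end Pair

/-! ### Comparison of the exponentials with those at an earlier time. -/

theorem abs_exp_neg_sub_exp_neg_le {a b : ℝ} (ha : 0 ≤ a) (hb : 0 ≤ b) :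
    |Real.exp (-a) - Real.exp (-b)| ≤ |a - b| := by
  have key : ∀ {a b : ℝ}, 0 ≤ a → a ≤ b → |Real.exp (-a) - Real.exp (-b)| ≤ |a - b| := by
    intro a b ha hab
    rw [abs_of_nonneg (sub_nonneg.2 (Real.exp_le_exp.2 (neg_le_neg hab))), abs_sub_comm,
      abs_of_nonneg (sub_nonneg.2 hab)]
    have h1 : Real.exp (-b) = Real.exp (-a) * Real.exp (-(b - a)) := by
      rw [← Real.exp_add]; ring_nf
    have h2 := Real.one_sub_le_exp_neg (b - a)
    have h3 : Real.exp (-a) ≤ 1 := Real.exp_le_one_iff.2 (by linarith)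
    have h4 := Real.exp_pos (-a)
    rw [h1]
    nlinarith
  rcases le_total a b with h | h
  · exact key ha h
  · rw [abs_sub_comm, abs_sub_comm a]; exact key hb h

/-- Decouples the product of the two limits. If `s b ≥ 1`, then `s² a b ≥ s a`; otherwise `exp(1 - s
b) ≥ 1` already dominates. -/
theorem exp_neg_mul_mul_le {s a b : ℝ} (hs : 0 ≤ s) (ha : 0 ≤ a) (hb : 0 ≤ b) :
    Real.exp (-(s ^ 2 * (a * b))) ≤
      Real.exp (-(s * a)) + Real.exp 1 * Real.exp (-(s * b)) := by
  rcases le_total 1 (s * b) with h | h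
  · have h1 : Real.exp (-(s ^ 2 * (a * b))) ≤ Real.exp (-(s * a)) :=
      Real.exp_le_exp.2 (by nlinarith [mul_nonneg hs ha])
    have h2 := mul_pos (Real.exp_pos 1) (Real.exp_pos (-(s * b)))
    linarith
  · have h0 : 0 ≤ s ^ 2 * (a * b) := by positivity
    rw [← Real.exp_add]
    have h1 : Real.exp (-(s ^ 2 * (a * b))) ≤ 1 := Real.exp_le_one_iff.2 (by linarith)
    have h2 : 1 ≤ Real.exp (1 + -(s * b)) := Real.one_le_exp (by linarith)
    linarith [Real.exp_pos (-(s * a))]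

/-- Both exponentials are positive and below their earlier values, so they differ by at most the
larger of these. -/
theorem abs_exp_neg_sub_exp_neg_le_of_le {a a₀ b b₀ : ℝ} (ha : a₀ ≤ a) (hb : b₀ ≤ b) :
    |Real.exp (-a) - Real.exp (-b)| ≤
      |Real.exp (-a₀) - Real.exp (-b₀)| + Real.exp (-b₀) := by
  have h1 : Real.exp (-a) ≤ Real.exp (-a₀) := Real.exp_le_exp.2 (neg_le_neg ha)
  have h2 : Real.exp (-b) ≤ Real.exp (-b₀) := Real.exp_le_exp.2 (neg_le_neg hb)
  have h3 := le_abs_self (Real.exp (-a₀) - Real.exp (-b₀))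
  have h4 := abs_nonneg (Real.exp (-a₀) - Real.exp (-b₀))
  rw [abs_le]
  constructor <;> linarith [Real.exp_pos (-a), Real.exp_pos (-b)]

/-- The limit on survival, weighted by `exp (-s * ·)`. -/
noncomputable def survivalWeight (ν μ s : ℝ) (x : ℕ → ℕ) : ℝ :=
  {x | seqLimit ν μ x ≠ 0}.indicator (fun x => Real.exp (-(s * seqLimit ν μ x))) x

/-- The indicator of a vanishing limit in spite of survival up to generation `m + 1`. -/
noncomputable def lateExtinction (ν μ : ℝ) (m : ℕ) (x : ℕ → ℕ) : ℝ :=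
  {x | seqLimit ν μ x = 0 ∧ x (m + 1) ≠ 0}.indicator 1 x

theorem survivalWeight_nonneg (ν μ s : ℝ) (x : ℕ → ℕ) : 0 ≤ survivalWeight ν μ s x :=
  Set.indicator_nonneg (fun _ _ => (Real.exp_pos _).le) x

theorem lateExtinction_nonneg (ν μ : ℝ) (m : ℕ) (x : ℕ → ℕ) : 0 ≤ lateExtinction ν μ m x :=
  Set.indicator_nonneg (fun _ _ => zero_le_one) x

theorem measurableSet_lateExtinction (ν μ : ℝ) (m : ℕ) :
    MeasurableSet {x : ℕ → ℕ | seqLimit ν μ x = 0 ∧ x (m + 1) ≠ 0} :=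
  (measurableSet_seqLimit_eq_zero ν μ).inter
    (measurableSet_eq_fun (measurable_pi_apply (m + 1)) measurable_const).compl

/-- Comparison of the exponentials at time `k` with those at an earlier time `l`. -/
theorem abs_exp_pairSum_sub_le {ν μ : ℝ} (hν : 0 < ν) (hμ : 1 < μ) {n k l : ℕ} (hlk : l ≤ k)
    {p : (ℕ → ℕ) × (ℕ → ℕ)} (h1 : 0 ≤ seqLimit ν μ p.1) (h2 : 0 ≤ seqLimit ν μ p.2)
    (hz1 : ∀ k j : ℕ, k ≤ j → p.1 k = 0 → p.1 j = 0)
    (hz2 : ∀ k j : ℕ, k ≤ j → p.2 k = 0 → p.2 j = 0) :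
    |Real.exp (-(1 / (ν * n) * pairSum k p)) - Real.exp (-(ν * μ ^ k / ((μ - 1) * n) *
        (seqLimit ν μ p.1 * seqLimit ν μ p.2)))| ≤
      |Real.exp (-(1 / (ν * n) * pairSum l p)) - Real.exp (-(ν * μ ^ l / ((μ - 1) * n) *
        (seqLimit ν μ p.1 * seqLimit ν μ p.2)))| +
      ((survivalWeight ν μ √(ν * μ ^ l / ((μ - 1) * n)) p.1 +
        Real.exp 1 * survivalWeight ν μ √(ν * μ ^ l / ((μ - 1) * n)) p.2) +
      (lateExtinction ν μ (l / 2) p.1 + lateExtinction ν μ (l / 2) p.2)) := by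
  have hμ1 : 0 < μ - 1 := by linarith
  set s := √(ν * μ ^ l / ((μ - 1) * n)) with hs
  have hs0 : 0 ≤ s := Real.sqrt_nonneg _
  have hs2 : s ^ 2 = ν * μ ^ l / ((μ - 1) * n) := Real.sq_sqrt (by positivity)
  have e1 := survivalWeight_nonneg ν μ s p.1
  have e2 := mul_nonneg (Real.exp_pos 1).le (survivalWeight_nonneg ν μ s p.2)
  have e3 := lateExtinction_nonneg ν μ (l / 2) p.1
  have e4 := lateExtinction_nonneg ν μ (l / 2) p.2
  -- With a vanishing limit the second exponential is 1 at both times. Either a process is extinct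
  -- by generation `l / 2 + 1` and the sum is frozen, or the late-extinction indicator pays the
  -- trivial bound 1.
  by_cases hW : seqLimit ν μ p.1 = 0 ∨ seqLimit ν μ p.2 = 0
  · have hW0 : seqLimit ν μ p.1 * seqLimit ν μ p.2 = 0 := mul_eq_zero.2 hW
    rw [hW0, mul_zero, mul_zero]
    by_cases hext : p.1 (l / 2 + 1) = 0 ∨ p.2 (l / 2 + 1) = 0
    · rw [pairSum_eq_of_extinct hlk (hext.imp (fun h j hj => hz1 _ j hj h)
        fun h j hj => hz2 _ j hj h)]
      linarith
    · push Not at hext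
      have h5 : 1 ≤ lateExtinction ν μ (l / 2) p.1 + lateExtinction ν μ (l / 2) p.2 := by
        rcases hW with h | h
        · have : lateExtinction ν μ (l / 2) p.1 = 1 :=
            Set.indicator_of_mem (⟨h, hext.1⟩ : p.1 ∈ {x : ℕ → ℕ | _ ∧ _}) 1
          linarith
        · have : lateExtinction ν μ (l / 2) p.2 = 1 :=
            Set.indicator_of_mem (⟨h, hext.2⟩ : p.2 ∈ {x : ℕ → ℕ | _ ∧ _}) 1
          linarith
      have h6 : |Real.exp (-(1 / (ν * n) * pairSum k p)) - Real.exp (-0)| ≤ 1 := by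
        have hA : 0 ≤ 1 / (ν * n) * pairSum k p := mul_nonneg (by positivity) (pairSum_nonneg k p)
        have : Real.exp (-(1 / (ν * n) * pairSum k p)) ≤ 1 := Real.exp_le_one_iff.2 (by linarith)
        rw [neg_zero, Real.exp_zero, abs_le]
        constructor <;> linarith [Real.exp_pos (-(1 / (ν * n) * pairSum k p))]
      linarith [abs_nonneg (Real.exp (-(1 / (ν * n) * pairSum l p)) - Real.exp (-0))]
  · push Not at hW
    have hWW := mul_nonneg h1 h2
    have hA : 1 / (ν * n) * pairSum l p ≤ 1 / (ν * n) * pairSum k p :=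
      mul_le_mul_of_nonneg_left (pairSum_mono hlk p) (by positivity)
    have hB : ν * μ ^ l / ((μ - 1) * n) * (seqLimit ν μ p.1 * seqLimit ν μ p.2) ≤
        ν * μ ^ k / ((μ - 1) * n) * (seqLimit ν μ p.1 * seqLimit ν μ p.2) := by
      gcongr
      exact hμ.le
    have h5 := abs_exp_neg_sub_exp_neg_le_of_le hA hB
    have h6 := exp_neg_mul_mul_le hs0 h1 h2
    rw [hs2] at h6
    have h7 : survivalWeight ν μ s p.1 = Real.exp (-(s * seqLimit ν μ p.1)) :=
      Set.indicator_of_mem (s := {x | seqLimit ν μ x ≠ 0}) hW.1 _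
    have h8 : survivalWeight ν μ s p.2 = Real.exp (-(s * seqLimit ν μ p.2)) :=
      Set.indicator_of_mem (s := {x | seqLimit ν μ x ≠ 0}) hW.2 _
    rw [h7, h8]
    linarith

section Pair

variable {gp fp gm fm : PMF ℕ} {μ ν κ : ℝ}

theorem integrable_survivalWeight (hg : HasMean gp ν) (hf : HasMean fp μ)
    (hν : 0 < ν) (hμ : 1 < μ) (hκ₀ : 0 < κ) (hκ₁ : κ ≤ 1) (hfκ : HasFiniteMoment fp (1 + κ))
    {s : ℝ} (hs : 0 ≤ s) : Integrable (survivalWeight ν μ s) (delayedBranchingLaw gp fp) :=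
  (integrable_exp_seqLimit hg hf hν hμ hκ₀ hκ₁ hfκ hs).indicator
    (measurableSet_seqLimit_eq_zero ν μ).compl

theorem integrable_lateExtinction (m : ℕ) :
    Integrable (lateExtinction ν μ m) (delayedBranchingLaw gp fp) :=
  (integrable_const (1 : ℝ)).indicator (measurableSet_lateExtinction ν μ m)

/-- The quantitative form of the comparison, with the cut-off time `l` still free. -/
theorem exists_integral_abs_exp_sub_le (hgp : HasMean gp ν) (hfp : HasMean fp μ)
    (hgm : HasMean gm ν) (hfm : HasMean fm μ) (hν : 0 < ν) (hμ : 1 < μ) (hκ₀ : 0 < κ) (hκ₁ : κ ≤ 1)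
    (hfpκ : HasFiniteMoment fp (1 + κ)) (hfmκ : HasFiniteMoment fm (1 + κ)) :
    ∃ K c : ℝ, 0 ≤ K ∧ 0 < c ∧ c < 1 ∧ ∀ n : ℕ, 0 < n → ∀ k : ℕ,
      (∫ p, |Real.exp (-(1 / (ν * n) * pairSum k p)) - Real.exp (-(ν * μ ^ k / ((μ - 1) * n) *
          (seqLimit ν μ p.1 * seqLimit ν μ p.2)))|
          ∂(delayedBranchingLaw gp fp).prod (delayedBranchingLaw gm fm) ≤
        K * ((μ ^ k) ^ (1 - κ / 8) / n)) ∧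
      ∀ l ≤ k, ∀ j : ℕ, ν * μ ^ j ≤ √(ν * μ ^ l / ((μ - 1) * n)) →
      ∫ p, |Real.exp (-(1 / (ν * n) * pairSum k p)) - Real.exp (-(ν * μ ^ k / ((μ - 1) * n) *
          (seqLimit ν μ p.1 * seqLimit ν μ p.2)))|
          ∂(delayedBranchingLaw gp fp).prod (delayedBranchingLaw gm fm) ≤
        K * ((μ ^ l) ^ (1 - κ / 8) / n) + K * c ^ j + K * c ^ (l / 2) := by
  obtain ⟨K, hK, hKb⟩ := exists_integral_abs_pairSum_sub_le hgp hfp hgm hfm hν hμ hκ₀ hκ₁ hfpκ hfmκ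
  obtain ⟨cp, hcp0, hcp1, hcp⟩ := exists_survival_rate hfp hμ hκ₀ hκ₁ hfpκ
  obtain ⟨cm, hcm0, hcm1, hcm⟩ := exists_survival_rate hfm hμ hκ₀ hκ₁ hfmκ
  have hμ1 : 0 < μ - 1 := by linarith
  obtain ⟨hp1, hp2⟩ := hcp gp ν hgp hν
  obtain ⟨hm1, hm2⟩ := hcm gm ν hgm hν
  set Pr := (delayedBranchingLaw gp fp).prod (delayedBranchingLaw gm fm) with hPr
  let D : ℕ → ℕ → (ℕ → ℕ) × (ℕ → ℕ) → ℝ := fun n k p =>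
    |Real.exp (-(1 / (ν * n) * pairSum k p)) - Real.exp (-(ν * μ ^ k / ((μ - 1) * n) *
      (seqLimit ν μ p.1 * seqLimit ν μ p.2)))|
  have hW1 : ∀ᵐ p ∂Pr, 0 ≤ seqLimit ν μ p.1 :=
    Measure.quasiMeasurePreserving_fst.ae (ae_seqLimit_nonneg hgp hfp hν hμ hκ₀ hκ₁ hfpκ)
  have hW2 : ∀ᵐ p ∂Pr, 0 ≤ seqLimit ν μ p.2 :=
    Measure.quasiMeasurePreserving_snd.ae (ae_seqLimit_nonneg hgm hfm hν hμ hκ₀ hκ₁ hfmκ)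
  have hZ1 : ∀ᵐ p ∂Pr, ∀ k j : ℕ, k ≤ j → p.1 k = 0 → p.1 j = 0 :=
    Measure.quasiMeasurePreserving_fst.ae (ae_delayedBranchingLaw_absorbing gp fp)
  have hZ2 : ∀ᵐ p ∂Pr, ∀ k j : ℕ, k ≤ j → p.2 k = 0 → p.2 j = 0 :=
    Measure.quasiMeasurePreserving_snd.ae (ae_delayedBranchingLaw_absorbing gm fm)
  have hDm : ∀ n k, Measurable (D n k) := fun n k => by
    have h1 := (measurable_pairSum k).const_mul (1 / (ν * n))
    have h2 := (((measurable_seqLimit ν μ).comp measurable_fst).mul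
      ((measurable_seqLimit ν μ).comp measurable_snd) :
        Measurable fun p : (ℕ → ℕ) × (ℕ → ℕ) => seqLimit ν μ p.1 * seqLimit ν μ p.2).const_mul
          (ν * μ ^ k / ((μ - 1) * n))
    exact ((Real.measurable_exp.comp h1.neg).sub (Real.measurable_exp.comp h2.neg)).abs
  have hDle : ∀ n k, ∀ᵐ p ∂Pr, D n k p ≤ |1 / (ν * n) * pairSum k p -
      ν * μ ^ k / ((μ - 1) * n) * (seqLimit ν μ p.1 * seqLimit ν μ p.2)| := fun n k => by
    filter_upwards [hW1, hW2] with p h1 h2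
    have := pairSum_nonneg k p
    exact abs_exp_neg_sub_exp_neg_le (by positivity) (by positivity)
  have hDi : ∀ n : ℕ, 0 < n → ∀ k, Integrable (D n k) Pr := fun n hn k => by
    refine (hKb n hn k).1.mono (hDm n k).aestronglyMeasurable ?_
    filter_upwards [hDle n k] with p hp
    rw [Real.norm_of_nonneg (abs_nonneg _), Real.norm_eq_abs]
    exact hp
  have hDb : ∀ n : ℕ, 0 < n → ∀ k, ∫ p, D n k p ∂Pr ≤ K * ((μ ^ k) ^ (1 - κ / 8) / n) :=
    fun n hn k => (integral_mono_ae (hDi n hn k) (hKb n hn k).1.abs (hDle n k)).trans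
      (hKb n hn k).2
  set c := max cp cm with hc
  have hc0 : 0 < c := lt_max_of_lt_left hcp0
  -- `(1 + e) ν` collects the two survival weights, `2 ν` the two late extinctions.
  set K' := max K ((1 + Real.exp 1) * ν + 2 * ν) with hK'
  have hKK' : K ≤ K' := le_max_left _ _
  have hexp1 := Real.exp_pos 1
  have hK'1 : (1 + Real.exp 1) * ν ≤ K' := le_trans (by linarith) (le_max_right _ _)
  have hK'2 : 2 * ν ≤ K' := le_trans (by nlinarith) (le_max_right _ _)
  refine ⟨K', c, hK.trans hKK', hc0, max_lt hcp1 hcm1, fun n hn k => ⟨?_, ?_⟩⟩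
  · exact (hDb n hn k).trans (mul_le_mul_of_nonneg_right hKK' (by positivity))
  intro l hl j hj
  set s := √(ν * μ ^ l / ((μ - 1) * n)) with hs
  have hs0 : 0 ≤ s := Real.sqrt_nonneg _
  have i1 : Integrable (fun p : (ℕ → ℕ) × (ℕ → ℕ) => survivalWeight ν μ s p.1) Pr :=
    (integrable_survivalWeight hgp hfp hν hμ hκ₀ hκ₁ hfpκ hs0).comp_fst _
  have i2 : Integrable (fun p : (ℕ → ℕ) × (ℕ → ℕ) => survivalWeight ν μ s p.2) Pr :=
    (integrable_survivalWeight hgm hfm hν hμ hκ₀ hκ₁ hfmκ hs0).comp_snd _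
  have i3 : Integrable (fun p : (ℕ → ℕ) × (ℕ → ℕ) => lateExtinction ν μ (l / 2) p.1) Pr :=
    (integrable_lateExtinction (l / 2)).comp_fst _
  have i4 : Integrable (fun p : (ℕ → ℕ) × (ℕ → ℕ) => lateExtinction ν μ (l / 2) p.2) Pr :=
    (integrable_lateExtinction (l / 2)).comp_snd _
  have b1 : ∫ p, survivalWeight ν μ s p.1 ∂Pr ≤ ν * c ^ j := by
    rw [hPr, integral_fun_fst, probReal_univ, one_smul]
    refine (hp1 j s hj).trans ?_
    gcongr
    exact le_max_left _ _
  have b2 : ∫ p, survivalWeight ν μ s p.2 ∂Pr ≤ ν * c ^ j := by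
    rw [hPr, integral_fun_snd, probReal_univ, one_smul]
    refine (hm1 j s hj).trans ?_
    gcongr
    exact le_max_right _ _
  have b3 : ∫ p, lateExtinction ν μ (l / 2) p.1 ∂Pr ≤ ν * c ^ (l / 2) := by
    rw [hPr, integral_fun_fst, probReal_univ, one_smul]
    refine ((integral_indicator_one (measurableSet_lateExtinction ν μ (l / 2))).trans_le
      (hp2 (l / 2))).trans ?_
    gcongr
    exact le_max_left _ _
  have b4 : ∫ p, lateExtinction ν μ (l / 2) p.2 ∂Pr ≤ ν * c ^ (l / 2) := by
    rw [hPr, integral_fun_snd, probReal_univ, one_smul]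
    refine ((integral_indicator_one (measurableSet_lateExtinction ν μ (l / 2))).trans_le
      (hm2 (l / 2))).trans ?_
    gcongr
    exact le_max_right _ _
  have i12 : Integrable (fun p : (ℕ → ℕ) × (ℕ → ℕ) => survivalWeight ν μ s p.1 +
      Real.exp 1 * survivalWeight ν μ s p.2) Pr := i1.add (i2.const_mul _)
  have i34 : Integrable (fun p : (ℕ → ℕ) × (ℕ → ℕ) => lateExtinction ν μ (l / 2) p.1 +
      lateExtinction ν μ (l / 2) p.2) Pr := i3.add i4
  have i14 : Integrable (fun p : (ℕ → ℕ) × (ℕ → ℕ) => (survivalWeight ν μ s p.1 +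
      Real.exp 1 * survivalWeight ν μ s p.2) + (lateExtinction ν μ (l / 2) p.1 +
      lateExtinction ν μ (l / 2) p.2)) Pr := i12.add i34
  calc ∫ p, D n k p ∂Pr
      ≤ ∫ p, (D n l p + ((survivalWeight ν μ s p.1 + Real.exp 1 * survivalWeight ν μ s p.2) +
        (lateExtinction ν μ (l / 2) p.1 + lateExtinction ν μ (l / 2) p.2))) ∂Pr := by
        refine integral_mono_ae (hDi n hn k) ((hDi n hn l).add i14) ?_
        filter_upwards [hW1, hW2, hZ1, hZ2] with p h1 h2 h3 h4
        exact abs_exp_pairSum_sub_le hν hμ hl h1 h2 h3 h4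
    _ = ∫ p, D n l p ∂Pr + ((∫ p, survivalWeight ν μ s p.1 ∂Pr +
          Real.exp 1 * ∫ p, survivalWeight ν μ s p.2 ∂Pr) +
        (∫ p, lateExtinction ν μ (l / 2) p.1 ∂Pr + ∫ p, lateExtinction ν μ (l / 2) p.2 ∂Pr)) := by
        rw [integral_add (hDi n hn l) i14, integral_add i12 i34,
          integral_add i1 (i2.const_mul _), integral_add i3 i4, integral_const_mul]
    _ ≤ K * ((μ ^ l) ^ (1 - κ / 8) / n) + ((ν * c ^ j + Real.exp 1 * (ν * c ^ j)) +
          (ν * c ^ (l / 2) + ν * c ^ (l / 2))) := by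
        gcongr
        exact hDb n hn l
    _ = K * ((μ ^ l) ^ (1 - κ / 8) / n) + ((1 + Real.exp 1) * ν) * c ^ j +
          (2 * ν) * c ^ (l / 2) := by ring
    _ ≤ _ := by gcongr

end Pair

/-! ### From geometric to polynomial rates: choice of the cut-off. -/

/-- Write `c = μ^d` with `d < 0`; then `μ^l ≥ x/μ` gives `c^l ≤ (x/μ)^d`. -/
theorem pow_le_mul_rpow_of_le_pow {μ c x : ℝ} (hμ : 1 < μ) (hc : 0 < c) (hx : 0 < x) (hc1 : c < 1)
    {l : ℕ} (hxl : x ≤ μ ^ (l + 1)) :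
    c ^ l ≤ μ ^ (-(Real.log c / Real.log μ)) * x ^ (Real.log c / Real.log μ) := by
  have hμ0 : 0 < μ := by linarith
  have hlog : 0 < Real.log μ := Real.log_pos hμ
  set d := Real.log c / Real.log μ with hd
  have hd0 : d ≤ 0 := div_nonpos_of_nonpos_of_nonneg (Real.log_neg hc hc1).le hlog.le
  have hcd : c = μ ^ d := by
    rw [Real.rpow_def_of_pos hμ0, hd, mul_div_cancel₀ _ hlog.ne', Real.exp_log hc]
  calc c ^ l = (μ ^ l) ^ d := by
        rw [hcd, ← Real.rpow_mul_natCast hμ0.le, ← Real.rpow_natCast_mul hμ0.le, mul_comm]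
    _ ≤ (x / μ) ^ d := by
        refine Real.rpow_le_rpow_of_nonpos (by positivity) ?_ hd0
        rw [div_le_iff₀ hμ0, ← pow_succ]
        exact hxl
    _ = μ ^ (-d) * x ^ d := by
        rw [Real.div_rpow hx.le hμ0.le, Real.rpow_neg hμ0.le, div_eq_inv_mul]

/-- Optimization of the cut-off time in the comparison estimate. -/
theorem exists_polynomial_rate {μ ν β K c : ℝ} (hμ : 1 < μ) (hν : 0 < ν) (hβ₀ : 0 < β)
    (hβ₁ : β < 1) (hK : 0 ≤ K) (hc₀ : 0 < c) (hc₁ : c < 1) {I : ℕ → ℕ → ℝ}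
    (hI : ∀ n : ℕ, 0 < n → ∀ k : ℕ, I n k ≤ K * ((μ ^ k) ^ (1 - β) / n) ∧
      ∀ l ≤ k, ∀ j : ℕ, ν * μ ^ j ≤ √(ν * μ ^ l / ((μ - 1) * n)) →
        I n k ≤ K * ((μ ^ l) ^ (1 - β) / n) + K * c ^ j + K * c ^ (l / 2)) :
    ∃ b : ℝ, 0 < b ∧ ∃ C : ℝ, ∀ᶠ n : ℕ in atTop, ∀ k : ℕ, I n k ≤ C * (n : ℝ) ^ (-b) := by
  have hμ0 : 0 < μ := by linarith
  have hμ1 : 0 < μ - 1 := by linarith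
  set d := Real.log c / Real.log μ with hd
  have hd0 : d < 0 := div_neg_of_neg_of_pos (Real.log_neg hc₀ hc₁) (Real.log_pos hμ)
  set a := √(ν / (μ * (μ - 1))) / ν with ha
  have ha0 : 0 < a := by positivity
  -- `β²` comes from `(1 + β)(1 - β) - 1 = -β²` in the `L¹` error, and `-βd/2` from `c^j` with `μ^j`
  -- of order at least `n^(β/2)`.
  refine ⟨min (β ^ 2) (β / 2 * -d), lt_min (by positivity)
    (mul_pos (by positivity) (neg_pos.2 hd0)), K + K * (μ ^ (-d) * a ^ d) + K * μ ^ (-d), ?_⟩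
  set b := min (β ^ 2) (β / 2 * -d) with hb
  have hlim : Tendsto (fun n : ℕ => a * (n : ℝ) ^ (β / 2)) atTop atTop :=
    ((tendsto_rpow_atTop (by positivity)).comp tendsto_natCast_atTop_atTop).const_mul_atTop ha0
  filter_upwards [hlim.eventually_ge_atTop 1, eventually_gt_atTop 0] with n hna hn k
  have hN1 : (1 : ℝ) ≤ n := by exact_mod_cast hn
  have hN0 : (0 : ℝ) < n := by linarith
  set N : ℝ := (n : ℝ) with hN
  obtain ⟨h1, h2⟩ := hI n hn k
  have hnb : 0 ≤ N ^ (-b) := by positivity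
  have hmain : ∀ l : ℕ, μ ^ l ≤ N ^ (1 + β) → (μ ^ l) ^ (1 - β) / N ≤ N ^ (-b) := by
    intro l hl
    calc (μ ^ l) ^ (1 - β) / N ≤ (N ^ (1 + β)) ^ (1 - β) / N := by
          gcongr
      _ = N ^ (-β ^ 2) := by
          rw [← Real.rpow_mul hN0.le, ← Real.rpow_sub_one hN0.ne']
          congr 1
          ring
      _ ≤ N ^ (-b) := Real.rpow_le_rpow_of_exponent_le hN1 (neg_le_neg (min_le_left _ _))
  have hdN : (N ^ (β / 2)) ^ d ≤ N ^ (-b) := by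
    rw [← Real.rpow_mul hN0.le]
    refine Real.rpow_le_rpow_of_exponent_le hN1 ?_
    have := min_le_right (β ^ 2) (β / 2 * -d)
    linarith
  have hμd : 0 ≤ μ ^ (-d) := by positivity
  have had : 0 ≤ a ^ d := by positivity
  by_cases hk : μ ^ k ≤ N ^ (1 + β)
  · refine h1.trans ((mul_le_mul_of_nonneg_left (hmain k hk) hK).trans ?_)
    gcongr
    have : 0 ≤ K * (μ ^ (-d) * a ^ d) := by positivity
    have : 0 ≤ K * μ ^ (-d) := by positivity
    linarith
  push Not at hk
  -- The cut-off is the last time with `μ^l ≤ n^(1+β)`. There the `L¹` bound still works, while `μ^l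
  -- / n` is already of order `n^β`, so the square root below reaches order `n^(β/2)`.
  obtain ⟨l, hl1, hl2⟩ := exists_nat_pow_near (Real.one_le_rpow hN1 (by linarith : 0 ≤ 1 + β)) hμ
  have hlk : l ≤ k := ((pow_lt_pow_iff_right₀ hμ).1 (hl1.trans_lt hk)).le
  have hsqrt : a * N ^ (β / 2) ≤ √(ν * μ ^ l / ((μ - 1) * N)) / ν := by
    rw [ha, div_mul_eq_mul_div]
    refine div_le_div_of_nonneg_right ?_ hν.le
    refine Real.le_sqrt_of_sq_le ?_
    rw [mul_pow, Real.sq_sqrt (by positivity), ← Real.rpow_mul_natCast hN0.le]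
    have e : β / 2 * (2 : ℕ) = (1 + β) - 1 := by push_cast; ring
    rw [e, Real.rpow_sub_one hN0.ne', div_mul_div_comm, div_le_div_iff₀ (by positivity)
      (by positivity)]
    rw [pow_succ] at hl2
    calc ν * N ^ (1 + β) * ((μ - 1) * N) ≤ ν * (μ ^ l * μ) * ((μ - 1) * N) := by gcongr
      _ = ν * μ ^ l * (μ * (μ - 1) * N) := by ring
  obtain ⟨j, hj1, hj2⟩ := exists_nat_pow_near (hna.trans hsqrt) hμ
  have hj := h2 l hlk j (by rw [mul_comm]; exact (le_div_iff₀ hν).1 hj1)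
  have hcj : c ^ j ≤ μ ^ (-d) * a ^ d * N ^ (-b) := by
    refine (pow_le_mul_rpow_of_le_pow hμ hc₀ (by positivity : 0 < a * N ^ (β / 2)) hc₁
      (hsqrt.trans hj2.le)).trans ?_
    rw [← hd, Real.mul_rpow ha0.le (by positivity), ← mul_assoc]
    gcongr
  -- Here `μ^(l/2+1)` even exceeds `n^((1+β)/2)`; the weaker `n^(β/2)` lets the same exponent serve.
  have hcl : c ^ (l / 2) ≤ μ ^ (-d) * N ^ (-b) := by
    refine (pow_le_mul_rpow_of_le_pow hμ hc₀ (by positivity : 0 < N ^ (β / 2)) hc₁ ?_).trans ?_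
    · refine le_of_sq_le_sq ?_ (by positivity)
      rw [← Real.rpow_mul_natCast hN0.le, ← pow_mul]
      calc N ^ (β / 2 * (2 : ℕ)) ≤ N ^ (1 + β) :=
            Real.rpow_le_rpow_of_exponent_le hN1 (by push_cast; linarith)
        _ ≤ μ ^ (l + 1) := hl2.le
        _ ≤ μ ^ ((l / 2 + 1) * 2) := pow_le_pow_right₀ hμ.le (by omega)
    · rw [← hd]
      gcongr
  calc I n k ≤ K * ((μ ^ l) ^ (1 - β) / N) + K * c ^ j + K * c ^ (l / 2) := hj
    _ ≤ K * N ^ (-b) + K * (μ ^ (-d) * a ^ d * N ^ (-b)) + K * (μ ^ (-d) * N ^ (-b)) := by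
        gcongr
        exact hmain l hl1
    _ = _ := by ring

/-! ### Transfer to the given processes. -/

theorem proposition5p2 {Ω : Type*} [MeasurableSpace Ω] (P : Measure Ω) [IsProbabilityMeasure P]
    (gp fp gm fm : PMF ℕ) (κ μ ν : ℝ) (hκ₀ : 0 < κ) (hκ₁ : κ ≤ 1) (hμ : 1 < μ) (hν : 0 < ν)
    (hfp : HasFiniteMoment fp (1 + κ)) (hfm : HasFiniteMoment fm (1 + κ))
    (hfpμ : HasMean fp μ) (hfmμ : HasMean fm μ) (hgpν : HasMean gp ν) (hgmν : HasMean gm ν)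
    (Zp Zm : ℕ → Ω → ℕ)
    (hZp : IsDelayedBranchingProcess P gp fp Zp) (hZm : IsDelayedBranchingProcess P gm fm Zm)
    (hindep : IndepFun (fun ω k => Zp k ω) (fun ω k => Zm k ω) P) :
    (∀ᵐ ω ∂P, Tendsto (fun k => normalizedSize Zp ν μ k ω) atTop
      (𝓝 (martingaleLimit Zp ν μ ω))) ∧
    (∀ᵐ ω ∂P, Tendsto (fun k => normalizedSize Zm ν μ k ω) atTop
      (𝓝 (martingaleLimit Zm ν μ ω))) ∧
    ∃ b : ℝ, 0 < b ∧ ∃ C : ℝ, ∀ᶠ n : ℕ in atTop, ∀ k : ℕ, 1 ≤ k →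
      |∫ ω, (Real.exp (-(1 / (ν * n)) *
            ∑ i ∈ Finset.Icc 2 (k + 1), (Zp ((i + 1) / 2) ω : ℝ) * (Zm (i / 2) ω : ℝ))
          - Real.exp (-(ν * μ ^ k / ((μ - 1) * n)) *
            (martingaleLimit Zp ν μ ω * martingaleLimit Zm ν μ ω))) ∂P|
        ≤ C * (n : ℝ) ^ (-b) := by
  have hZp' : HasLaw (fun ω k => Zp k ω) (delayedBranchingLaw gp fp) P := hZp
  have hZm' : HasLaw (fun ω k => Zm k ω) (delayedBranchingLaw gm fm) P := hZm
  have hpair : HasLaw (fun ω => ((fun k => Zp k ω, fun k => Zm k ω) : (ℕ → ℕ) × (ℕ → ℕ)))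
      ((delayedBranchingLaw gp fp).prod (delayedBranchingLaw gm fm)) P :=
    ⟨hZp'.aemeasurable.prodMk hZm'.aemeasurable, by
      rw [hindep.map_prod_eq_prod_map_map hZp'.aemeasurable hZm'.aemeasurable, hZp'.map_eq,
        hZm'.map_eq]⟩
  have hconv : ∀ {g f : PMF ℕ} {Z : ℕ → Ω → ℕ}, HasMean g ν → HasMean f μ →
      HasFiniteMoment f (1 + κ) → HasLaw (fun ω k => Z k ω) (delayedBranchingLaw g f) P →
      ∀ᵐ ω ∂P, Tendsto (fun k => normalizedSize Z ν μ k ω) atTop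
        (𝓝 (martingaleLimit Z ν μ ω)) := by
    intro g f Z hg hf hfκ hZ
    have h := (exists_seqLimit_bound hg hf hν hμ hκ₀ hκ₁ hfκ).1
    rw [← hZ.map_eq] at h
    exact ae_of_ae_map hZ.aemeasurable h
  refine ⟨hconv hgpν hfpμ hfp hZp', hconv hgmν hfmμ hfm hZm', ?_⟩
  obtain ⟨K, c, hK, hc₀, hc₁, h⟩ :=
    exists_integral_abs_exp_sub_le hgpν hfpμ hgmν hfmμ hν hμ hκ₀ hκ₁ hfp hfm
  obtain ⟨b, hb, C, hC⟩ := exists_polynomial_rate hμ hν (by positivity : 0 < κ / 8)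
    (by linarith : κ / 8 < 1) hK hc₀ hc₁ h
  refine ⟨b, hb, C, ?_⟩
  filter_upwards [hC] with n hn k _
  refine le_trans ?_ (hn k)
  refine le_trans (le_of_eq ?_) abs_integral_le_integral_abs
  congr 1
  -- By independence the pair of paths has the product law, and the normalized sizes and limits are
  -- by definition the sequence functionals evaluated along the paths.
  rw [← hpair.integral_comp]
  · refine integral_congr_ae (ae_of_all _ fun ω => ?_)
    simp only [neg_mul, Function.comp_apply]
    rfl
  · have h1 := (measurable_pairSum k).const_mul (1 / (ν * n))
    have h2 := (((measurable_seqLimit ν μ).comp measurable_fst).mul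
      ((measurable_seqLimit ν μ).comp measurable_snd) :
        Measurable fun p : (ℕ → ℕ) × (ℕ → ℕ) => seqLimit ν μ p.1 * seqLimit ν μ p.2).const_mul
          (ν * μ ^ k / ((μ - 1) * n))
    exact ((Real.measurable_exp.comp h1.neg).sub
      (Real.measurable_exp.comp h2.neg)).aestronglyMeasurable
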